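/- Let $N\ge 1$ be an integer, $0<\alpha<N$, $p>1$, $q>1$, and let $$I_\alpha(x)=\frac{\Gamma\left(\frac{N-\alpha}{2}\right)}{\Gamma\left(\frac{\alpha}{2}\right)\pi^{N/2}2^{\alpha}}\,\frac{1}{|x|^{N-\alpha}},\qquad x\in\mathbb{R}^N\setminus\{0\},$$ be the Riesz potential. Consider the system $$(P)\qquad \begin{cases}-\Delta u+u=\dfrac{2p}{p+q}\,(I_\alpha*|v|^{q})\,|u|^{p-2}u & \text{in }\mathbb{R}^N,\\[2mm] -\Delta v+v=\dfrac{2q}{p+q}\,(I_\alpha*|u|^{p})\,|v|^{q-2}v & \text{in }\mathbb{R}^N,\end{cases}$$ for real-valued $u,v$. A pair $(u,v)\in H^1(\mathbb{R}^N)\times H^1(\mathbb{R}^N)$ is called a weak solution of $(P)$ if for all $\varphi,\psi\in C_c^\infty(\mathbb{R}^N)$ $$\int_{\mathbb{R}^N}(\nabla u\cdot\nabla\varphi+u\varphi)\,dx=\frac{2p}{p+q}\int_{\mathbb{R}^N}(I_\alpha*|v|^q)|u|^{p-2}u\,\varphi\,dx,$$ $$\int_{\mathbb{R}^N}(\nabla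 v\cdot\nabla\psi+v\psi)\,dx=\frac{2q}{p+q}\int_{\mathbb{R}^N}(I_\alpha*|u|^p)|v|^{q-2}v\,\psi\,dx.$$ **Theorem.** Let $\theta_1>1$ and $\theta_2>1$ satisfy $\frac1{\theta_1}+\frac1{\theta_2}=\frac{N+\alpha}{N}$, and let $(u,v)$ be a weak solution of $(P)$ with $$u\in H^1(\mathbb{R}^N)\cap W^{2,2}_{loc}(\mathbb{R}^N)\cap W^{1,\theta_1p}(\mathbb{R}^N),\qquad v\in H^1(\mathbb{R}^N)\cap W^{2,2}_{loc}(\mathbb{R}^N)\cap W^{1,\theta_2q}(\mathbb{R}^N).$$ If $$(p+q)N\le 2(N+\alpha)\qquad\text{or}\qquad (p+q)(N-2)\ge 2(N+\alpha),$$ then $u=v=0$ almost everywhere in $\mathbb{R}^N$. -/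

import Mathlib

open MeasureTheory
open scoped ContDiff Convolution

noncomputable section

namespace HartreeSystem

/-- The Euclidean space `ℝ^N`, with its Euclidean norm and Lebesgue measure `volume`. -/
abbrev RN (N : ℕ) : Type := EuclideanSpace ℝ (Fin N)

/-- The classical partial derivative `∂φ/∂x_i` at the point `x`. -/
def partialDeriv {N : ℕ} (i : Fin N) (φ : RN N → ℝ) (x : RN N) : ℝ :=
  fderiv ℝ φ x (EuclideanSpace.single i 1)

/-- Test functions: elements of `C_c^∞(ℝ^N)`. -/
def IsTestFunction {N : ℕ} (φ : RN N → ℝ) : Prop :=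
  ContDiff ℝ ∞ φ ∧ HasCompactSupport φ

/-- `g` is the weak (distributional) partial derivative of `u` in the direction `x_i`. -/
def IsWeakPartial {N : ℕ} (i : Fin N) (u g : RN N → ℝ) : Prop :=
  LocallyIntegrable u ∧ LocallyIntegrable g ∧
    ∀ φ : RN N → ℝ, IsTestFunction φ →
      ∫ x, u x * partialDeriv i φ x = -∫ x, g x * φ x

/-- `G = (G_1, …, G_N)` is the weak gradient of `u`. -/
def IsWeakGradient {N : ℕ} (u : RN N → ℝ) (G : Fin N → RN N → ℝ) : Prop :=
  ∀ i, IsWeakPartial i u (G i)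

/-- `u ∈ W^{1,r}(ℝ^N)`, for a real exponent `r ≥ 1`. -/
def MemW1 {N : ℕ} (r : ℝ) (u : RN N → ℝ) : Prop :=
  MemLp u (ENNReal.ofReal r) ∧
    ∃ G : Fin N → RN N → ℝ, IsWeakGradient u G ∧ ∀ i, MemLp (G i) (ENNReal.ofReal r)

/-- `u ∈ H^1(ℝ^N) = W^{1,2}(ℝ^N)`. -/
def MemH1 {N : ℕ} (u : RN N → ℝ) : Prop := MemW1 2 u

/-- `f ∈ L^2_loc(ℝ^N)`. -/
def MemL2Loc {N : ℕ} (f : RN N → ℝ) : Prop :=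
  ∀ K : Set (RN N), IsCompact K → MemLp f 2 (volume.restrict K)

/-- `u ∈ W^{2,2}_loc(ℝ^N)`: `u` has weak derivatives of first and second order, and all of them,
together with `u`, are in `L^2_loc`. -/
def MemW22Loc {N : ℕ} (u : RN N → ℝ) : Prop :=
  MemL2Loc u ∧
    ∃ G : Fin N → RN N → ℝ, IsWeakGradient u G ∧
      ∀ i, MemL2Loc (G i) ∧
        ∃ H : Fin N → RN N → ℝ, IsWeakGradient (G i) H ∧ ∀ j, MemL2Loc (H j)

/-- The Riesz potential `I_α` on `ℝ^N`. -/
def rieszPotential (N : ℕ) (α : ℝ) (x : RN N) : ℝ :=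
  Real.Gamma ((N - α) / 2) / (Real.Gamma (α / 2) * Real.pi ^ ((N : ℝ) / 2) * (2 : ℝ) ^ α)
    * (1 / ‖x‖ ^ ((N : ℝ) - α))

/-- The convolution `I_α ∗ f`. -/
def rieszConv {N : ℕ} (α : ℝ) (f : RN N → ℝ) : RN N → ℝ :=
  rieszPotential N α ⋆[ContinuousLinearMap.mul ℝ ℝ, volume] f

/-- `u` satisfies, in the weak sense, the equation `-Δu + u = c (I_α ∗ |w|^s) |u|^{r-2} u` in
`ℝ^N`. If `u ∈ L^{ρ r}` and `w ∈ L^{σ s}` with `ρ, σ > 1` and `1/ρ + 1/σ = (N + α)/N`, then the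
integral on the right converges absolutely, by the Hardy-Littlewood-Sobolev inequality. -/
def WeakEquation {N : ℕ} (α c r s : ℝ) (u w : RN N → ℝ) : Prop :=
  ∃ G : Fin N → RN N → ℝ, IsWeakGradient u G ∧
    ∀ φ : RN N → ℝ, IsTestFunction φ →
      ∫ x, ((∑ i, G i x * partialDeriv i φ x) + u x * φ x) =
        c * ∫ x, rieszConv α (fun y => |w y| ^ s) x * (|u x| ^ (r - 2) * u x) * φ x

/-- `(u, v)` is a weak solution, in `H^1(ℝ^N) × H^1(ℝ^N)`, of the system
`-Δu + u = (2p/(p+q)) (I_α ∗ |v|^q) |u|^{p-2} u`,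
`-Δv + v = (2q/(p+q)) (I_α ∗ |u|^p) |v|^{q-2} v` in `ℝ^N`. -/
structure IsWeakSolution {N : ℕ} (α p q : ℝ) (u v : RN N → ℝ) : Prop where
  memH1_left : MemH1 u
  memH1_right : MemH1 v
  equation_left : WeakEquation α (2 * p / (p + q)) p q u v
  equation_right : WeakEquation α (2 * q / (p + q)) q p v u

end HartreeSystem

end

noncomputable section

namespace HartreeSystem

open Set Metric Filter Topology
open scoped ENNReal NNReal

variable {N : ℕ}

/-! The proof is a Pohozaev argument. Write A for the sum of the squared L² norms of the gradients
of u and v, B for the sum of the squared L² norms of u and v, and E for the integral of (I_α ∗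
|v|^q)|u|^p. Testing each equation with its own solution (`RegularSolution.energy`) and adding gives
A + B = 2E, because 2p/(p+q) + 2q/(p+q) = 2. Testing with x·∇u and x·∇v and adding gives (N/2 - 1)A
+ (N/2)B = 2(N+α)E/(p+q). Eliminating E, ((p+q)N - 2(N+α))(A + B) = 2(p+q)A, ((p+q)(N-2) - 2(N+α))(A
+ B) = -2(p+q)B, and these are two forms of one identity. The first alternative of the hypothesis
forces A = 0, hence u = v = 0 by square integrability; the second forces B = 0.

The dilation identity is obtained as a limit, with x replaced by the compactly supported fields
`dilationField n`. Its local half is `RegularSolution.tendsto_pohozaev`: by `integral_test_mul` the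
weak equation accepts ζ ∂_j u as a test function. W^{2,2}_loc makes the gradient terms meaningful,
and W^{1,θ₁p} (W^{1,θ₂q} for v) does so for the nonlinear term, through
`HLSAdmissible.exists_pairingBound`.

The nonlocal half is `HLSAdmissible.tendsto_pohozaev`. By the chain rule `IsWeakPartial.abs_rpow`,
the nonlinear terms of both equations together form a double integral of the Riesz kernel against
derivatives of |u|^p and |v|^q. Integrating by parts in x and in y and adding
(`HLSAdmissible.integral_normKernel_symm`), the gradient of the kernel appears only multiplied by
X(x) - X(y), which absorbs the extra singularity. For X(x) = x the kernel has homogeneity -(N-α) and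
the divergence contributes 2N, so the factor is N+α. Convergence of all double integrals rests on
`hardy_littlewood_sobolev`. -/

/-! ### The Hardy-Littlewood-Sobolev inequality. -/

/-- The singular kernel `‖z‖ ^ (-s)` with values in `[0, ⊤]`. -/
def powKernel (N : ℕ) (s : ℝ) (z : RN N) : ℝ≥0∞ := ENNReal.ofReal (‖z‖ ^ (-s))

lemma measurable_powKernel (s : ℝ) : Measurable (powKernel N s) := by
  unfold powKernel
  fun_prop

lemma powKernel_sub_comm (s : ℝ) (x y : RN N) : powKernel N s (x - y) = powKernel N s (y - x) := by
  simp only [powKernel, norm_sub_rev]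

lemma lintegral_eq_rpow_mul_lintegral_smul (f : RN N → ℝ≥0∞) {ρ : ℝ} (hρ : 0 < ρ) :
    ∫⁻ z, f z = ENNReal.ofReal (ρ ^ (N : ℝ)) * ∫⁻ w, f (ρ • w) := by
  have he : MeasurableEmbedding (fun w : RN N => ρ • w) :=
    (Homeomorph.smulOfNeZero ρ hρ.ne').measurableEmbedding
  rw [← he.lintegral_map, Measure.map_addHaar_smul _ hρ.ne', lintegral_smul_measure, smul_eq_mul,
    ← mul_assoc, ← ENNReal.ofReal_mul (by positivity), finrank_euclideanSpace_fin,
    Real.rpow_natCast, abs_of_pos (by positivity), mul_inv_cancel₀ (by positivity)]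
  simp

lemma powKernel_smul (s : ℝ) {ρ : ℝ} (hρ : 0 < ρ) (w : RN N) :
    powKernel N s (ρ • w) = ENNReal.ofReal (ρ ^ (-s)) * powKernel N s w := by
  rw [powKernel, powKernel, norm_smul, Real.norm_of_nonneg hρ.le,
    Real.mul_rpow hρ.le (norm_nonneg _), ENNReal.ofReal_mul (by positivity)]

/-- Homogeneity of the kernel: this reduces balls of radius ρ and their complements to radius one,
leaving the power of ρ explicit. -/
lemma lintegral_indicator_powKernel_scaling (s : ℝ) {ρ : ℝ} (hρ : 0 < ρ) {A B : Set (RN N)}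
    (hAB : ∀ w, ρ • w ∈ A ↔ w ∈ B) :
    ∫⁻ z, A.indicator (powKernel N s) z =
      ENNReal.ofReal (ρ ^ ((N : ℝ) - s)) * ∫⁻ z, B.indicator (powKernel N s) z := by
  rw [lintegral_eq_rpow_mul_lintegral_smul _ hρ, sub_eq_add_neg, Real.rpow_add hρ,
    ENNReal.ofReal_mul (by positivity), mul_assoc]
  congr 1
  rw [← lintegral_const_mul' _ _ ENNReal.ofReal_ne_top]
  refine lintegral_congr fun w => ?_
  by_cases hw : w ∈ B
  · rw [indicator_of_mem hw, indicator_of_mem ((hAB w).2 hw), powKernel_smul s hρ]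
  · rw [indicator_of_notMem hw, indicator_of_notMem (fun h => hw ((hAB w).1 h)), mul_zero]

lemma lintegral_ball_powKernel (hN : 1 ≤ N) {s : ℝ} (hs : s < N) :
    ∃ C : ℝ≥0, ∀ ρ : ℝ, 0 < ρ → ∫⁻ z, (ball 0 ρ).indicator (powKernel N s) z ≤
      C * ENNReal.ofReal (ρ ^ ((N : ℝ) - s)) := by
  have hi : IntegrableOn (fun z : RN N => ‖z‖ ^ (-s)) (ball 0 1) := by
    refine integrableOn_ball_of_norm_le_rpow (C := 1) (α := s) (by simpa using hN) (by simpa using hs)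
      (Eventually.of_forall fun x => ?_)
      (measurable_norm.pow_const _).aestronglyMeasurable
    rw [one_mul, Real.norm_of_nonneg (by positivity)]
  have hfin : ∫⁻ z, (ball (0 : RN N) 1).indicator (powKernel N s) z ≠ ⊤ := by
    rw [lintegral_indicator measurableSet_ball]
    exact (hi.lintegral_lt_top).ne
  refine ⟨(∫⁻ z, (ball (0 : RN N) 1).indicator (powKernel N s) z).toNNReal, fun ρ hρ => ?_⟩
  rw [ENNReal.coe_toNNReal hfin, mul_comm]
  refine (lintegral_indicator_powKernel_scaling s hρ fun w => ?_).le
  simp only [mem_ball_zero_iff, norm_smul, Real.norm_of_nonneg hρ.le]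
  exact mul_lt_iff_lt_one_right hρ

lemma lintegral_compl_ball_powKernel {s : ℝ} (hs : (N : ℝ) < s) :
    ∃ C : ℝ≥0, ∀ ρ : ℝ, 0 < ρ → ∫⁻ z, (ball 0 ρ)ᶜ.indicator (powKernel N s) z ≤
      C * ENNReal.ofReal (ρ ^ ((N : ℝ) - s)) := by
  have hs0 : 0 ≤ s := (Nat.cast_nonneg N).trans hs.le
  -- Outside the unit ball (1 + ‖z‖)/2 ≤ ‖z‖, which accounts for the factor `2 ^ s`.
  have hi : Integrable (fun z : RN N => (2 : ℝ) ^ s * (1 + ‖z‖) ^ (-s)) :=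
    (integrable_one_add_norm (by simpa using hs)).const_mul _
  have hfin : ∫⁻ z, (ball (0 : RN N) 1)ᶜ.indicator (powKernel N s) z ≠ ⊤ := by
    refine ((lintegral_mono fun z => ?_).trans_lt hi.lintegral_lt_top).ne
    by_cases hz : z ∈ (ball (0 : RN N) 1)ᶜ
    · rw [indicator_of_mem hz]
      have hz1 : 1 ≤ ‖z‖ := by simpa using hz
      refine ENNReal.ofReal_le_ofReal ?_
      have : ((1 + ‖z‖) / 2) ^ s ≤ ‖z‖ ^ s := Real.rpow_le_rpow (by positivity) (by linarith) hs0
      rw [Real.div_rpow (by positivity) (by positivity)] at this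
      rw [Real.rpow_neg (by positivity), Real.rpow_neg (by positivity), ← div_eq_mul_inv]
      rw [inv_le_comm₀ (by positivity) (by positivity), inv_div]
      exact this
    · rw [indicator_of_notMem hz]; exact zero_le
  refine ⟨(∫⁻ z, (ball (0 : RN N) 1)ᶜ.indicator (powKernel N s) z).toNNReal, fun ρ hρ => ?_⟩
  rw [ENNReal.coe_toNNReal hfin, mul_comm]
  refine (lintegral_indicator_powKernel_scaling s hρ fun w => ?_).le
  simp only [mem_compl_iff, mem_ball_zero_iff, norm_smul, Real.norm_of_nonneg hρ.le, not_lt]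
  exact le_mul_iff_one_le_right hρ

/-- The potential of the part of `h` below the level `t`. -/
lemma lintegral_powKernel_mul_le_of_le (hN : 1 ≤ N) {s r : ℝ} (hsN : s < N)
    (hr : 1 < r) (hrs : N * (r - 1) < s * r) :
    ∃ C : ℝ≥0, ∀ h : RN N → ℝ≥0∞, Measurable h → ∫⁻ y, h y ^ r ≤ 1 → ∀ t : ℝ, 0 < t → ∀ x,
      ∫⁻ y in {y | h y ≤ ENNReal.ofReal t}, powKernel N s (x - y) * h y ≤
        C * ENNReal.ofReal (t ^ (1 - r * (1 - s / N))) := by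
  have hN0 : (0 : ℝ) < N := by exact_mod_cast hN
  set r' : ℝ := r.conjExponent with hr'
  have hc : r.HolderConjugate r' := Real.HolderConjugate.conjExponent hr
  have hr'0 : 0 < r' := hc.symm.pos
  have hr'e : r' = r / (r - 1) := rfl
  have hfar : (N : ℝ) < s * r' := by
    rw [hr'e, ← mul_div_assoc, lt_div_iff₀ (by linarith)]; exact hrs
  obtain ⟨C₁, hC₁⟩ := lintegral_ball_powKernel hN hsN
  obtain ⟨C₂, hC₂⟩ := lintegral_compl_ball_powKernel hfar
  refine ⟨C₁ + C₂ ^ (1 / r'), fun h hm hh t ht x => ?_⟩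
  -- This radius balances the two contributions: inside the ball `h` is replaced by its bound `t`,
  -- outside Hölder's inequality is used, and both give the same power of `t`. The assumption `hrs`
  -- says that `s * r' > N`, so the tail of the kernel is in L^{r'}.
  set ρ : ℝ := t ^ (-r / N) with hρd
  have hρ : 0 < ρ := by positivity
  have hK := measurable_powKernel (N := N) s
  have hA : Measurable fun z : RN N => (ball 0 ρ).indicator (powKernel N s) z :=
    hK.indicator measurableSet_ball
  have hB : Measurable fun z : RN N => (ball 0 ρ)ᶜ.indicator (powKernel N s) z :=
    hK.indicator measurableSet_ball.compl
  calc ∫⁻ y in {y | h y ≤ ENNReal.ofReal t}, powKernel N s (x - y) * h y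
      ≤ ∫⁻ y, ((ball 0 ρ).indicator (powKernel N s) (x - y) * ENNReal.ofReal t +
          (ball 0 ρ)ᶜ.indicator (powKernel N s) (x - y) * h y) := by
        rw [← lintegral_indicator (measurableSet_le hm measurable_const)]
        refine lintegral_mono fun y => ?_
        by_cases hy : h y ≤ ENNReal.ofReal t
        · rw [indicator_of_mem (by exact hy)]
          by_cases hxy : x - y ∈ ball (0 : RN N) ρ
          · rw [indicator_of_mem hxy, indicator_of_notMem (by simpa using hxy), zero_mul, add_zero]
            gcongr
          · rw [indicator_of_notMem hxy, indicator_of_mem (by exact hxy), zero_mul, zero_add]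
        · rw [indicator_of_notMem (by exact hy)]; exact zero_le
    _ = (∫⁻ z, (ball 0 ρ).indicator (powKernel N s) z) * ENNReal.ofReal t +
          ∫⁻ y, (ball 0 ρ)ᶜ.indicator (powKernel N s) (x - y) * h y := by
        rw [lintegral_add_left (by fun_prop), lintegral_mul_const _ (by fun_prop),
          lintegral_sub_left_eq_self (fun z => (ball 0 ρ).indicator (powKernel N s) z) x]
    _ ≤ C₁ * ENNReal.ofReal (ρ ^ ((N : ℝ) - s)) * ENNReal.ofReal t +
          (C₂ * ENNReal.ofReal (ρ ^ ((N : ℝ) - s * r'))) ^ (1 / r') * 1 := by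
        gcongr
        · exact hC₁ ρ hρ
        · refine (ENNReal.lintegral_mul_le_Lp_mul_Lq volume hc.symm (by fun_prop)
            hm.aemeasurable).trans ?_
          gcongr
          · refine le_trans (le_of_eq ?_) (hC₂ ρ hρ)
            rw [← lintegral_sub_left_eq_self (fun z => (ball 0 ρ)ᶜ.indicator _ z) x]
            refine lintegral_congr fun y => ?_
            by_cases hxy : x - y ∈ (ball (0 : RN N) ρ)ᶜ
            · rw [indicator_of_mem hxy, indicator_of_mem hxy, powKernel, powKernel,
                ENNReal.ofReal_rpow_of_nonneg (by positivity) hr'0.le,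
                ← Real.rpow_mul (by positivity), neg_mul]
            · rw [indicator_of_notMem hxy, indicator_of_notMem hxy, ENNReal.zero_rpow_of_pos hr'0]
          · exact (ENNReal.rpow_le_rpow hh (by have := hc.pos; positivity)).trans (by simp)
    _ = (C₁ + C₂ ^ (1 / r') : ℝ≥0) * ENNReal.ofReal (t ^ (1 - r * (1 - s / N))) := by
        rw [mul_one, ENNReal.mul_rpow_of_nonneg _ _ (by positivity),
          ENNReal.ofReal_rpow_of_nonneg (by positivity) (by positivity), mul_assoc,
          ← ENNReal.ofReal_mul (by positivity), hρd, ← Real.rpow_mul ht.le, ← Real.rpow_mul ht.le,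
          ← Real.rpow_mul ht.le, ENNReal.coe_add, ENNReal.coe_rpow_of_nonneg _ (by positivity),
          add_mul]
        have e1 : t ^ (-r / N * (N - s)) * t = t ^ (1 - r * (1 - s / N)) := by
          nth_rewrite 2 [← Real.rpow_one t]
          rw [← Real.rpow_add ht]
          congr 1
          field_simp
          ring
        rw [e1]
        congr 4
        · rw [hr'e]
          have : r - 1 ≠ 0 := by linarith
          field_simp
          ring

/-- Where `h y ^ r ≤ f x ^ p`, the function `h` is below the level `f x ^ (p / r)`. The potential
bound at that level, multiplied by `f x`, is a multiple of exactly `f x ^ p` by the scaling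
relation, and this integrates to at most one. -/
lemma lintegral_mul_powKernel_half (hN : 1 ≤ N) {s p r : ℝ} (hs : 0 < s) (hsN : s < N)
    (hp : 1 < p) (hr : 1 < r) (hpr : 1 / p + 1 / r = 2 - s / N) :
    ∃ C : ℝ≥0, ∀ f h : RN N → ℝ≥0∞, Measurable f → Measurable h →
      ∫⁻ x, f x ^ p ≤ 1 → ∫⁻ y, h y ^ r ≤ 1 →
      ∫⁻ x, ∫⁻ y, {y | h y ^ r ≤ f x ^ p}.indicator
        (fun y => f x * (powKernel N s (x - y) * h y)) y ≤ C := by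
  have hN0 : (0 : ℝ) < N := by exact_mod_cast hN
  have hp0 : 0 < p := by linarith
  have hr0 : 0 < r := by linarith
  have hp1 : 1 / p < 1 := by rw [div_lt_one hp0]; exact hp
  have hrs : N * (r - 1) < s * r := by
    have h1 : 1 - s / N < 1 / r := by linarith
    rw [lt_div_iff₀ hr0] at h1
    have h2 : N * (r - 1) - s * r = N * ((1 - s / N) * r - 1) := by field_simp; ring
    nlinarith
  obtain ⟨C, hC⟩ := lintegral_powKernel_mul_le_of_le hN hsN hr hrs
  refine ⟨C, fun f h hf hh hf1 hh1 => ?_⟩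
  have hfin : ∀ᵐ x, f x ^ p < ⊤ :=
    ae_lt_top (by fun_prop) (hf1.trans_lt ENNReal.one_lt_top).ne
  calc ∫⁻ x, ∫⁻ y, {y | h y ^ r ≤ f x ^ p}.indicator
        (fun y => f x * (powKernel N s (x - y) * h y)) y
      ≤ ∫⁻ x, C * f x ^ p := by
        refine lintegral_mono_ae ?_
        filter_upwards [hfin] with x hx
        have hx' : f x ≠ ⊤ := fun h' => by simp [h', hp0] at hx
        rcases eq_or_ne (f x) 0 with h0 | h0
        · simp [h0]
        have hm : MeasurableSet {y | h y ^ r ≤ f x ^ p} :=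
          measurableSet_le (by fun_prop) measurable_const
        have hm1 := measurable_powKernel (N := N) s
        rw [lintegral_indicator hm, lintegral_const_mul _ (by fun_prop)]
        set a : ℝ := (f x).toReal with ha
        have ha0 : 0 < a := ENNReal.toReal_pos h0 hx'
        have hfa : f x = ENNReal.ofReal a := (ENNReal.ofReal_toReal hx').symm
        have hset : {y | h y ^ r ≤ f x ^ p} = {y | h y ≤ ENNReal.ofReal (a ^ (p / r))} := by
          ext y
          simp only [mem_ofPred_eq]
          rw [← ENNReal.le_rpow_inv_iff hr0, hfa, ENNReal.ofReal_rpow_of_pos ha0,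
            ENNReal.ofReal_rpow_of_pos (by positivity), ← Real.rpow_mul ha0.le, div_eq_mul_inv]
        rw [hset]
        refine (mul_le_mul_right (hC h hh hh1 _ (by positivity) x) _).trans (le_of_eq ?_)
        rw [hfa, mul_left_comm, ← ENNReal.ofReal_mul ha0.le, ENNReal.ofReal_rpow_of_pos ha0,
          ← Real.rpow_mul ha0.le]
        nth_rewrite 1 [← Real.rpow_one a]
        rw [← Real.rpow_add ha0]
        congr 3
        have h1 : s / N = 2 - 1 / p - 1 / r := by linarith
        rw [h1]
        field_simp
        ring
    _ ≤ C := by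
        rw [lintegral_const_mul _ (by fun_prop)]
        exact mul_le_of_le_one_right zero_le hf1

/-- Every pair (x, y) satisfies `h y ^ r ≤ f x ^ p` or the reverse inequality. The second region
becomes the first after exchanging the roles of (f, p) and (h, r), under which the scaling relation
is symmetric. -/
lemma lintegral_mul_powKernel_normalized (hN : 1 ≤ N) {s p r : ℝ} (hs : 0 < s) (hsN : s < N)
    (hp : 1 < p) (hr : 1 < r) (hpr : 1 / p + 1 / r = 2 - s / N) :
    ∃ C : ℝ≥0, ∀ f h : RN N → ℝ≥0∞, Measurable f → Measurable h →
      ∫⁻ x, f x ^ p ≤ 1 → ∫⁻ y, h y ^ r ≤ 1 →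
      ∫⁻ x, ∫⁻ y, f x * (powKernel N s (x - y) * h y) ≤ C := by
  obtain ⟨C₁, hC₁⟩ := lintegral_mul_powKernel_half hN hs hsN hp hr hpr
  obtain ⟨C₂, hC₂⟩ := lintegral_mul_powKernel_half hN hs hsN hr hp (by rw [add_comm]; exact hpr)
  refine ⟨C₁ + C₂, fun f h hf hh hf1 hh1 => ?_⟩
  have hm1 := measurable_powKernel (N := N) s
  have hms : MeasurableSet {z : RN N × RN N | h z.2 ^ r ≤ f z.1 ^ p} :=
    measurableSet_le (by fun_prop) (by fun_prop)
  have hms' : MeasurableSet {z : RN N × RN N | f z.1 ^ p ≤ h z.2 ^ r} :=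
    measurableSet_le (by fun_prop) (by fun_prop)
  have hmF : Measurable fun z : RN N × RN N => f z.1 * (powKernel N s (z.1 - z.2) * h z.2) := by
    fun_prop
  have hm2 : Measurable fun z : RN N × RN N => {y | h y ^ r ≤ f z.1 ^ p}.indicator
      (fun y => f z.1 * (powKernel N s (z.1 - y) * h y)) z.2 := hmF.indicator hms
  have hm3 : Measurable fun z : RN N × RN N => {x | f x ^ p ≤ h z.2 ^ r}.indicator
      (fun x => h z.2 * (powKernel N s (z.2 - x) * f x)) z.1 := by
    convert! hmF.indicator hms' using 2 with z
    simp only [indicator, mem_ofPred_eq, powKernel_sub_comm s z.1 z.2]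
    split_ifs <;> ring
  calc ∫⁻ x, ∫⁻ y, f x * (powKernel N s (x - y) * h y)
      ≤ ∫⁻ x, ∫⁻ y, ({y | h y ^ r ≤ f x ^ p}.indicator
          (fun y => f x * (powKernel N s (x - y) * h y)) y +
          {x | f x ^ p ≤ h y ^ r}.indicator
          (fun x => h y * (powKernel N s (y - x) * f x)) x) := by
        refine lintegral_mono fun x => lintegral_mono fun y => ?_
        rcases le_total (h y ^ r) (f x ^ p) with hxy | hxy
        · rw [indicator_of_mem (by exact hxy)]
          exact le_self_add
        · rw [indicator_of_mem (s := {x | f x ^ p ≤ h y ^ r}) (by exact hxy),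
            powKernel_sub_comm s y x]
          refine le_trans (le_of_eq ?_) le_add_self
          ring
    _ = (∫⁻ x, ∫⁻ y, {y | h y ^ r ≤ f x ^ p}.indicator
          (fun y => f x * (powKernel N s (x - y) * h y)) y) +
        ∫⁻ y, ∫⁻ x, {x | f x ^ p ≤ h y ^ r}.indicator
          (fun x => h y * (powKernel N s (y - x) * f x)) x := by
        rw [lintegral_lintegral_swap (f := fun y x => {x | f x ^ p ≤ h y ^ r}.indicator
          (fun x => h y * (powKernel N s (y - x) * f x)) x)
          (hm3.comp measurable_swap).aemeasurable, ← lintegral_add_left hm2.lintegral_prod_right']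
        refine lintegral_congr fun x => ?_
        exact lintegral_add_left (hm2.comp measurable_prodMk_left) _
    _ ≤ (C₁ + C₂ : ℝ≥0) := by
        rw [ENNReal.coe_add]
        exact add_le_add (hC₁ f h hf hh hf1 hh1) (hC₂ h f hh hf hh1 hf1)

lemma lintegral_div_norm_rpow {f : RN N → ℝ≥0∞} {p : ℝ} (hp : 0 < p) {A : ℝ≥0∞}
    (hA : (∫⁻ x, f x ^ p) ^ (1 / p) = A) (hA0 : A ≠ 0) (hAt : A ≠ ⊤) :
    ∫⁻ x, (A⁻¹ * f x) ^ p ≤ 1 := by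
  have h1 : ∫⁻ x, f x ^ p = A ^ p := by
    rw [← hA, ← ENNReal.rpow_mul, one_div_mul_cancel hp.ne', ENNReal.rpow_one]
  simp_rw [ENNReal.mul_rpow_of_nonneg _ _ hp.le]
  rw [lintegral_const_mul' _ _ (ENNReal.rpow_ne_top_of_nonneg hp.le (ENNReal.inv_ne_top.2 hA0)), h1,
    ← ENNReal.mul_rpow_of_nonneg _ _ hp.le, ENNReal.inv_mul_cancel hA0 hAt, ENNReal.one_rpow]

/-- The **Hardy-Littlewood-Sobolev inequality**. -/
theorem hardy_littlewood_sobolev (hN : 1 ≤ N) {s p r : ℝ} (hs : 0 < s) (hsN : s < N)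
    (hp : 1 < p) (hr : 1 < r) (hpr : 1 / p + 1 / r = 2 - s / N) :
    ∃ C : ℝ≥0, ∀ f h : RN N → ℝ≥0∞, AEMeasurable f → AEMeasurable h →
      ∫⁻ x, ∫⁻ y, f x * (powKernel N s (x - y) * h y) ≤
        C * ((∫⁻ x, f x ^ p) ^ (1 / p) * (∫⁻ y, h y ^ r) ^ (1 / r)) := by
  obtain ⟨C₀, hC₀⟩ := lintegral_mul_powKernel_normalized hN hs hsN hp hr hpr
  -- The constant is made nonzero so that the right-hand side is `⊤` when one norm is infinite and
  -- the other is nonzero.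
  obtain ⟨C, hC0, hC₁⟩ : ∃ C : ℝ≥0, C ≠ 0 ∧ C₀ ≤ C := ⟨C₀ + 1, by positivity, le_self_add⟩
  have hC := fun f h hf hh hf1 hh1 =>
    (hC₀ f h hf hh hf1 hh1).trans (ENNReal.coe_le_coe.2 hC₁)
  have hp0 : 0 < p := by linarith
  have hr0 : 0 < r := by linarith
  have main : ∀ f h : RN N → ℝ≥0∞, Measurable f → Measurable h →
      ∫⁻ x, ∫⁻ y, f x * (powKernel N s (x - y) * h y) ≤
        C * ((∫⁻ x, f x ^ p) ^ (1 / p) * (∫⁻ y, h y ^ r) ^ (1 / r)) := by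
    intro f h hf hh
    set A := (∫⁻ x, f x ^ p) ^ (1 / p) with hA
    set B := (∫⁻ y, h y ^ r) ^ (1 / r) with hB
    have hz : ∀ {g : RN N → ℝ≥0∞} {e : ℝ}, 0 < e → Measurable g →
        (∫⁻ x, g x ^ e) ^ (1 / e) = 0 → g =ᵐ[volume] 0 := by
      intro g e he hg h0
      rw [ENNReal.rpow_eq_zero_iff_of_pos (by positivity)] at h0
      exact ENNReal.ae_eq_zero_of_lintegral_rpow_eq_zero he.le hg.aemeasurable h0
    rcases eq_or_ne A 0 with hA0 | hA0
    · have h0 := hz hp0 hf hA0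
      refine le_of_eq_of_le ?_ zero_le
      rw [lintegral_eq_zero_of_ae_eq_zero]
      filter_upwards [h0] with x hx
      simp [hx]
    rcases eq_or_ne B 0 with hB0 | hB0
    · have h0 := hz hr0 hh hB0
      refine le_of_eq_of_le ?_ zero_le
      have : ∀ x, ∫⁻ y, f x * (powKernel N s (x - y) * h y) = 0 := fun x => by
        rw [lintegral_eq_zero_of_ae_eq_zero]
        filter_upwards [h0] with y hy
        simp [hy]
      simp [this]
    rcases eq_or_ne A ⊤ with hAt | hAt
    · rw [hAt, ENNReal.top_mul hB0, ENNReal.mul_top (by simpa using hC0)]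
      exact le_top
    rcases eq_or_ne B ⊤ with hBt | hBt
    · rw [hBt, ENNReal.mul_top hA0, ENNReal.mul_top (by simpa using hC0)]
      exact le_top
    have := hC (fun x => A⁻¹ * f x) (fun y => B⁻¹ * h y) (by fun_prop) (by fun_prop)
      (lintegral_div_norm_rpow hp0 hA.symm hA0 hAt) (lintegral_div_norm_rpow hr0 hB.symm hB0 hBt)
    calc ∫⁻ x, ∫⁻ y, f x * (powKernel N s (x - y) * h y)
        = ∫⁻ x, ∫⁻ y, (A * B) * (A⁻¹ * f x * (powKernel N s (x - y) * (B⁻¹ * h y))) := by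
          refine lintegral_congr fun x => lintegral_congr fun y => ?_
          calc f x * (powKernel N s (x - y) * h y) 
              = (A * A⁻¹) * (B * B⁻¹) * (f x * (powKernel N s (x - y) * h y)) := by
                rw [ENNReal.mul_inv_cancel hA0 hAt, ENNReal.mul_inv_cancel hB0 hBt, one_mul,
                  one_mul]
            _ = _ := by ring
      _ = (A * B) * ∫⁻ x, ∫⁻ y, (A⁻¹ * f x * (powKernel N s (x - y) * (B⁻¹ * h y))) := by
          have hAB : A * B ≠ ⊤ := ENNReal.mul_ne_top hAt hBt
          simp_rw [lintegral_const_mul' _ _ hAB]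
      _ ≤ (A * B) * C := by gcongr
      _ = _ := mul_comm _ _
  refine ⟨C, fun f h hf hh => ?_⟩
  have h1 : ∫⁻ x, ∫⁻ y, f x * (powKernel N s (x - y) * h y) =
      ∫⁻ x, ∫⁻ y, hf.mk f x * (powKernel N s (x - y) * hh.mk h y) := by
    refine lintegral_congr_ae ?_
    filter_upwards [hf.ae_eq_mk] with x hx
    refine lintegral_congr_ae ?_
    filter_upwards [hh.ae_eq_mk] with y hy
    rw [hx, hy]
  have h2 : ∫⁻ x, f x ^ p = ∫⁻ x, hf.mk f x ^ p := 
    lintegral_congr_ae (by filter_upwards [hf.ae_eq_mk] with x hx; rw [hx])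
  have h3 : ∫⁻ x, h x ^ r = ∫⁻ x, hh.mk h x ^ r := 
    lintegral_congr_ae (by filter_upwards [hh.ae_eq_mk] with x hx; rw [hx])
  rw [h1, h2, h3]
  exact main _ _ hf.measurable_mk hh.measurable_mk

/-! ### Local Lebesgue spaces and mollification. -/

/-- `f ∈ L^r_loc(ℝ^N)`. -/
def MemLpLoc (r : ℝ≥0∞) (f : RN N → ℝ) : Prop :=
  ∀ K : Set (RN N), IsCompact K → MemLp f r (volume.restrict K)

lemma MemLpLoc.of_memLp {r : ℝ≥0∞} {f : RN N → ℝ} (hf : MemLp f r) : MemLpLoc r f :=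
  fun _ _ => hf.restrict _

lemma MemLpLoc.mono_exponent {r s : ℝ≥0∞} {f : RN N → ℝ} (hf : MemLpLoc r f) (h : s ≤ r) :
    MemLpLoc s f := fun K hK => by
  have : IsFiniteMeasure (volume.restrict K) := ⟨by simpa using hK.measure_lt_top⟩
  exact (hf K hK).mono_exponent h

lemma MemLpLoc.locallyIntegrable {r : ℝ≥0∞} {f : RN N → ℝ} (hf : MemLpLoc r f) (h : 1 ≤ r) :
    LocallyIntegrable f := by
  rw [locallyIntegrable_iff]
  exact fun K hK => memLp_one_iff_integrable.1 (hf.mono_exponent h K hK)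

lemma LocallyIntegrable.memLpLoc {f : RN N → ℝ} (hf : LocallyIntegrable f) : MemLpLoc 1 f :=
  fun _ hK => memLp_one_iff_integrable.2 (hf.integrableOn_isCompact hK)

lemma MemLpLoc.aestronglyMeasurable {r : ℝ≥0∞} {f : RN N → ℝ} (hf : MemLpLoc r f) :
    AEStronglyMeasurable f := by
  have : (volume : Measure (RN N)) = volume.restrict (⋃ n : ℕ, closedBall (0 : RN N) n) := by
    rw [iUnion_closedBall_nat, Measure.restrict_univ]
  rw [this, aestronglyMeasurable_iUnion_iff]
  exact fun n => (hf _ (isCompact_closedBall _ _)).1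

/-- A sequence of bump functions concentrating at the origin. -/
def mollifierBump (N n : ℕ) : ContDiffBump (0 : RN N) where
  rIn := (1 / 2) / (n + 1)
  rOut := 1 / (n + 1)
  rIn_pos := by positivity
  rIn_lt_rOut := by gcongr; norm_num

/-- The standard mollifiers. -/
def mollifier (N n : ℕ) : RN N → ℝ := (mollifierBump N n).normed volume

/-- The mollification of `f`. -/
def mollify (n : ℕ) (f : RN N → ℝ) : RN N → ℝ :=
  mollifier N n ⋆[ContinuousLinearMap.lsmul ℝ ℝ, volume] f

lemma mollify_apply (n : ℕ) (f : RN N → ℝ) (x : RN N) :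
    mollify n f x = ∫ y, mollifier N n (x - y) * f y := by
  simp [mollify, convolution_eq_swap]

lemma contDiff_mollifier (n : ℕ) : ContDiff ℝ ∞ (mollifier N n) :=
  (mollifierBump N n).contDiff_normed

lemma hasCompactSupport_mollifier (n : ℕ) : HasCompactSupport (mollifier N n) :=
  (mollifierBump N n).hasCompactSupport_normed

lemma mollifier_nonneg (n : ℕ) (x : RN N) : 0 ≤ mollifier N n x :=
  (mollifierBump N n).nonneg_normed x

lemma lintegral_mollifier (n : ℕ) : ∫⁻ x, ENNReal.ofReal (mollifier N n x) = 1 := by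
  rw [mollifier, ← ofReal_integral_eq_lintegral_ofReal (mollifierBump N n).integrable_normed
    (Eventually.of_forall (mollifier_nonneg n)), ContDiffBump.integral_normed, ENNReal.ofReal_one]

lemma mollifier_eq_zero {n : ℕ} {x : RN N} (hx : 1 ≤ ‖x‖) : mollifier N n x = 0 := by
  by_contra h
  have h1 : x ∈ Function.support ((mollifierBump N n).normed volume) := h
  rw [ContDiffBump.support_normed_eq, mem_ball_zero_iff] at h1
  have h2 : (mollifierBump N n).rOut ≤ 1 := by
    rw [mollifierBump, div_le_one (by positivity)]
    linarith [(Nat.cast_nonneg n : (0 : ℝ) ≤ n)]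
  linarith

lemma tendsto_mollifierBump_rOut :
    Tendsto (fun n => (mollifierBump N n).rOut) atTop (𝓝 0) :=
  tendsto_one_div_add_atTop_nhds_zero_nat

lemma contDiff_mollify (n : ℕ) {f : RN N → ℝ} (hf : LocallyIntegrable f) :
    ContDiff ℝ ∞ (mollify n f) :=
  (hasCompactSupport_mollifier n).contDiff_convolution_left _ (contDiff_mollifier n) hf

lemma ae_tendsto_mollify {f : RN N → ℝ} (hf : LocallyIntegrable f) :
    ∀ᵐ x, Tendsto (fun n => mollify n f x) atTop (𝓝 (f x)) := by
  -- Convergence at almost every point requires a bounded ratio of outer to inner radius; for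
  -- `mollifierBump` it is always 2.
  refine ContDiffBump.ae_convolution_tendsto_right_of_locallyIntegrable (K := 2)
    tendsto_mollifierBump_rOut (Eventually.of_forall fun n => le_of_eq ?_) hf
  simp only [mollifierBump]
  ring

lemma convolutionExistsAt_mollifier (n : ℕ) {f : RN N → ℝ} (hf : LocallyIntegrable f) (x : RN N) :
    ConvolutionExistsAt (mollifier N n) f x (ContinuousLinearMap.lsmul ℝ ℝ) volume :=
  (hasCompactSupport_mollifier n).convolutionExists_left _ (contDiff_mollifier n).continuous hf x

lemma mollify_sub (n : ℕ) {f g : RN N → ℝ} (hf : LocallyIntegrable f) (hg : LocallyIntegrable g) :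
    mollify n (f - g) = mollify n f - mollify n g := by
  funext x
  have h1 := (convolutionExistsAt_mollifier n hf x).integrable_swap
  have h2 := (convolutionExistsAt_mollifier n hg x).integrable_swap
  simp only [ContinuousLinearMap.lsmul_apply, smul_eq_mul] at h1 h2
  simp only [Pi.sub_apply, mollify_apply, mul_sub]
  exact integral_sub h1 h2

lemma partialDeriv_comp_sub_left (i : Fin N) {φ : RN N → ℝ} (hφ : Differentiable ℝ φ) (x y : RN N) :
    partialDeriv i (fun y => φ (x - y)) y = -partialDeriv i φ (x - y) := by
  have h1 : HasFDerivAt (fun y : RN N => x - y) (-ContinuousLinearMap.id ℝ (RN N)) y :=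
    (hasFDerivAt_id y).const_sub x
  have h2 := (hφ (x - y)).hasFDerivAt.comp y h1
  have h3 : HasFDerivAt (fun y => φ (x - y)) _ y := h2
  rw [partialDeriv, h3.fderiv]
  simp [partialDeriv]

/-- For fixed x the function y ↦ ρ_n(x - y) is a test function, so the definition of the weak
derivative applies to it. The sign from integrating by parts cancels the sign from differentiating
in y instead of x. -/
lemma partialDeriv_mollify (i : Fin N) (n : ℕ) {f g : RN N → ℝ} (h : IsWeakPartial i f g) :
    partialDeriv i (mollify n f) = mollify n g := by
  funext x
  obtain ⟨hf, hg, hw⟩ := h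
  have hd := (hasCompactSupport_mollifier n).hasFDerivAt_convolution_left
    (ContinuousLinearMap.lsmul ℝ ℝ) ((contDiff_mollifier n).of_le (by simp)) hf x
  have hdiff : Differentiable ℝ (mollifier N n) := (contDiff_mollifier n).differentiable (by simp)
  have htest : IsTestFunction (fun y => mollifier N n (x - y)) :=
    ⟨(contDiff_mollifier n).comp (contDiff_const.sub contDiff_id),
      (hasCompactSupport_mollifier n).comp_homeomorph (Homeomorph.subLeft x)⟩
  have hw1 := hw _ htest
  simp_rw [partialDeriv_comp_sub_left i hdiff, mul_neg, integral_neg, neg_inj] at hw1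
  have hcs : HasCompactSupport (fderiv ℝ (mollifier N n)) := (hasCompactSupport_mollifier n).fderiv ℝ
  have hc : Continuous (fderiv ℝ (mollifier N n)) := (contDiff_mollifier n).continuous_fderiv (by simp)
  have hint := (hcs.convolutionExists_left
    ((ContinuousLinearMap.lsmul ℝ ℝ : ℝ →L[ℝ] ℝ →L[ℝ] ℝ).precompL (RN N)) hc hf x).integrable_swap
  change fderiv ℝ (mollifier N n ⋆[ContinuousLinearMap.lsmul ℝ ℝ, volume] f) x _ = _
  rw [hd.fderiv, convolution_eq_swap, ContinuousLinearMap.integral_apply hint, mollify_apply]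
  rw [show ∫ y, mollifier N n (x - y) * g y = ∫ y, g y * mollifier N n (x - y) by
    simp_rw [mul_comm], ← hw1]
  refine integral_congr_ae (Eventually.of_forall fun y => ?_)
  simp [ContinuousLinearMap.precompL_apply, partialDeriv, mul_comm]

/-- Jensen's inequality: ρ_n(x - ·) is the density of a probability measure, for which the L¹ norm
is at most the L^r norm. -/
lemma enorm_mollify_rpow_le (n : ℕ) {f : RN N → ℝ} (hf : AEStronglyMeasurable f) {r : ℝ}
    (hr : 1 ≤ r) (x : RN N) :
    ‖mollify n f x‖ₑ ^ r ≤ ∫⁻ y, ENNReal.ofReal (mollifier N n (x - y)) * ‖f y‖ₑ ^ r := by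
  have hmc : Continuous (mollifier N n) := (contDiff_mollifier n).continuous
  have hm : Measurable fun y => ENNReal.ofReal (mollifier N n (x - y)) := by fun_prop
  set μ : Measure (RN N) := volume.withDensity fun y => ENNReal.ofReal (mollifier N n (x - y)) with hμ
  have : IsProbabilityMeasure μ := ⟨by
    rw [hμ, withDensity_apply _ MeasurableSet.univ, Measure.restrict_univ,
      lintegral_sub_left_eq_self (fun z => ENNReal.ofReal (mollifier N n z)) x,
      lintegral_mollifier]⟩
  have hfμ : AEStronglyMeasurable f μ := hf.mono_ac (withDensity_absolutelyContinuous _ _)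
  have hr0 : 0 < r := by linarith
  have h1 : ‖mollify n f x‖ₑ ≤ eLpNorm f 1 μ := by
    rw [mollify_apply, eLpNorm_one_eq_lintegral_enorm, hμ,
      lintegral_withDensity_eq_lintegral_mul₀ hm.aemeasurable hf.enorm]
    refine (enorm_integral_le_lintegral_enorm _).trans (le_of_eq (lintegral_congr fun y => ?_))
    rw [enorm_mul, Pi.mul_apply, Real.enorm_of_nonneg (mollifier_nonneg _ _)]
  have h2 : eLpNorm f 1 μ ≤ eLpNorm f (ENNReal.ofReal r) μ :=
    eLpNorm_le_eLpNorm_of_exponent_le (by simpa using hr) hfμ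
  have h3 := ENNReal.rpow_le_rpow (h1.trans h2) hr0.le
  refine h3.trans (le_of_eq ?_)
  rw [eLpNorm_eq_lintegral_rpow_enorm_toReal (by simpa using hr0) (by simp),
    ENNReal.toReal_ofReal hr0.le, ← ENNReal.rpow_mul, one_div_mul_cancel hr0.ne', ENNReal.rpow_one,
    hμ, lintegral_withDensity_eq_lintegral_mul₀ hm.aemeasurable (hf.enorm.pow_const _)]
  rfl

/-- The pointwise Jensen bound, integrated in x with Tonelli's theorem; each mollifier has total
mass one. -/
lemma eLpNorm_mollify_le (n : ℕ) {f : RN N → ℝ} (hf : AEStronglyMeasurable f) {r : ℝ}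
    (hr : 1 ≤ r) :
    eLpNorm (mollify n f) (ENNReal.ofReal r) ≤ eLpNorm f (ENNReal.ofReal r) := by
  have hr0 : 0 < r := by linarith
  have hmc : Continuous (mollifier N n) := (contDiff_mollifier n).continuous
  rw [eLpNorm_eq_lintegral_rpow_enorm_toReal (by simpa using hr0) (by simp),
    eLpNorm_eq_lintegral_rpow_enorm_toReal (by simpa using hr0) (by simp),
    ENNReal.toReal_ofReal hr0.le]
  gcongr 1
  calc ∫⁻ x, ‖mollify n f x‖ₑ ^ r
      ≤ ∫⁻ x, ∫⁻ y, ENNReal.ofReal (mollifier N n (x - y)) * ‖f y‖ₑ ^ r :=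
        lintegral_mono fun x => enorm_mollify_rpow_le n hf hr x
    _ = ∫⁻ y, ∫⁻ x, ENNReal.ofReal (mollifier N n (x - y)) * ‖f y‖ₑ ^ r := by
        refine lintegral_lintegral_swap ?_
        refine AEMeasurable.mul (Measurable.aemeasurable (by fun_prop)) ?_
        exact (hf.enorm.pow_const r).comp_snd
    _ = ∫⁻ y, ‖f y‖ₑ ^ r := by
        refine lintegral_congr fun y => ?_
        rw [lintegral_mul_const _ (by fun_prop),
          lintegral_sub_right_eq_self (fun z => ENNReal.ofReal (mollifier N n z)) y,
          lintegral_mollifier, one_mul]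

lemma tendsto_eLpNorm_mollify_sub_of_continuous {g : RN N → ℝ} (hg : Continuous g)
    (hgs : HasCompactSupport g) {r : ℝ≥0∞} {K : Set (RN N)} (hK : IsCompact K) :
    Tendsto (fun n => eLpNorm (mollify n g - g) r (volume.restrict K)) atTop (𝓝 0) := by
  have hKf : volume K < ⊤ := hK.measure_lt_top
  set M : ℝ≥0∞ := (volume K) ^ (1 / r.toReal) with hM
  have hMt : M ≠ ⊤ := ENNReal.rpow_ne_top_of_nonneg (by positivity) hKf.ne
  have huc := hgs.uniformContinuous_of_continuous hg
  have hunif : ∀ δ : ℝ, 0 < δ → ∀ᶠ n in atTop, ∀ x, ‖(mollify n g - g) x‖ ≤ δ := by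
    intro δ hδ
    obtain ⟨η, hη, hηg⟩ := Metric.uniformContinuous_iff.1 huc δ hδ
    filter_upwards [(tendsto_mollifierBump_rOut (N := N)).eventually (gt_mem_nhds hη)] with n hn x
    rw [Pi.sub_apply, ← dist_eq_norm]
    refine (mollifierBump N n).dist_normed_convolution_le hg.aestronglyMeasurable fun y hy => ?_
    exact (hηg ((mem_ball.1 hy).trans hn)).le
  have hlim : Tendsto (fun k : ℕ => M * ENNReal.ofReal (1 / ((k : ℝ) + 1))) atTop (𝓝 0) := by
    have h1 := ENNReal.tendsto_ofReal tendsto_one_div_add_atTop_nhds_zero_nat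
    have h2 := ENNReal.Tendsto.const_mul h1 (Or.inr hMt)
    simpa using h2
  rw [ENNReal.tendsto_nhds_zero]
  intro ε hε
  obtain ⟨k, hk⟩ := ((ENNReal.tendsto_nhds_zero.1 hlim) ε hε).exists
  filter_upwards [hunif (1 / ((k : ℝ) + 1)) (by positivity)] with n hn
  refine le_trans (eLpNorm_le_of_ae_bound (C := 1 / ((k : ℝ) + 1)) (Eventually.of_forall hn)) ?_
  rw [Measure.restrict_apply_univ, ← one_div]
  exact hk

/-- Density of compactly supported continuous functions, with an ε/3 argument: mollification
contracts L^r, and continuous functions of compact support are uniformly continuous. -/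
lemma tendsto_eLpNorm_mollify_sub_of_memLp {f : RN N → ℝ} {r : ℝ} (hr : 1 ≤ r)
    (hf : MemLp f (ENNReal.ofReal r)) {K : Set (RN N)} (hK : IsCompact K) :
    Tendsto (fun n => eLpNorm (mollify n f - f) (ENNReal.ofReal r) (volume.restrict K)) atTop
      (𝓝 0) := by
  have hr1 : 1 ≤ ENNReal.ofReal r := by simpa using hr
  rw [ENNReal.tendsto_nhds_zero]
  intro ε hε
  have hε3 : ε / 3 ≠ 0 := (ENNReal.div_pos hε.ne' (by simp)).ne'
  obtain ⟨g, hgs, hfg, hgc, hg⟩ := hf.exists_hasCompactSupport_eLpNorm_sub_le (by simp) hε3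
  have hlf : LocallyIntegrable f := hf.locallyIntegrable hr1
  have hlg : LocallyIntegrable g := hg.locallyIntegrable hr1
  filter_upwards [ENNReal.tendsto_nhds_zero.1 (tendsto_eLpNorm_mollify_sub_of_continuous hgc hgs
    (r := ENNReal.ofReal r) hK) _ (pos_iff_ne_zero.2 hε3)] with n hn
  have hdec : mollify n f - f = mollify n (f - g) + ((mollify n g - g) + (g - f)) := by
    rw [mollify_sub n hlf hlg]; abel
  have hmf := (contDiff_mollify n (hlf.sub hlg)).continuous.aestronglyMeasurable (μ := volume.restrict K)
  have hmg := (contDiff_mollify n hlg).continuous.aestronglyMeasurable (μ := volume.restrict K)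
  rw [hdec]
  refine (eLpNorm_add_le hmf ((hmg.sub hg.1.restrict).add (hg.1.restrict.sub hf.1.restrict))
    hr1).trans ?_
  refine (add_le_add le_rfl (eLpNorm_add_le (hmg.sub hg.1.restrict)
    (hg.1.restrict.sub hf.1.restrict) hr1)).trans ?_
  calc _ ≤ ε / 3 + (ε / 3 + ε / 3) := by
        gcongr
        · exact (eLpNorm_restrict_le _ _ _ _).trans
            ((eLpNorm_mollify_le n (hf.1.sub hg.1) hr).trans hfg)
        · rw [← neg_sub f g, eLpNorm_neg]
          exact (eLpNorm_restrict_le _ _ _ _).trans hfg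
    _ = ε := by rw [← add_assoc, ENNReal.add_thirds]

/-- The mollifiers vanish outside the unit ball, so on K the mollification sees only the values of f
on the closed 1-thickening of K. Cutting f off there reduces the claim to the global case. -/
lemma tendsto_eLpNorm_mollify_sub {f : RN N → ℝ} {r : ℝ} (hr : 1 ≤ r)
    (hf : MemLpLoc (ENNReal.ofReal r) f) {K : Set (RN N)} (hK : IsCompact K) :
    Tendsto (fun n => eLpNorm (mollify n f - f) (ENNReal.ofReal r) (volume.restrict K)) atTop
      (𝓝 0) := by
  have hK' : IsCompact (cthickening 1 K) := hK.cthickening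
  set f' := (cthickening 1 K).indicator f with hf'
  have hmem : MemLp f' (ENNReal.ofReal r) :=
    (memLp_indicator_iff_restrict hK'.measurableSet).2 (hf _ hK')
  refine (tendsto_eLpNorm_mollify_sub_of_memLp hr hmem hK).congr fun n => ?_
  refine eLpNorm_congr_ae ?_
  filter_upwards [ae_restrict_mem hK.measurableSet] with x hx
  rw [Pi.sub_apply, Pi.sub_apply, hf', indicator_of_mem (self_subset_cthickening K hx),
    mollify_apply, mollify_apply]
  congr 1
  refine integral_congr_ae (Eventually.of_forall fun y => ?_)
  by_cases hy : y ∈ cthickening 1 K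
  · simp only [indicator_of_mem hy]
  · have : 1 ≤ ‖x - y‖ := by
      by_contra h
      refine hy (mem_cthickening_of_dist_le y x 1 K hx ?_)
      rw [dist_comm, dist_eq_norm]
      exact (not_le.1 h).le
    simp only [mollifier_eq_zero this, zero_mul]

/-! ### Test functions -/

lemma IsTestFunction.continuous {φ : RN N → ℝ} (h : IsTestFunction φ) : Continuous φ :=
  h.1.continuous

lemma IsTestFunction.differentiable {φ : RN N → ℝ} (h : IsTestFunction φ) : Differentiable ℝ φ :=
  h.1.differentiable (by simp)

lemma contDiff_partialDeriv (i : Fin N) {φ : RN N → ℝ} (h : ContDiff ℝ ∞ φ) :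
    ContDiff ℝ ∞ (partialDeriv i φ) :=
  (h.fderiv_right (m := ∞) (by simp)).clm_apply contDiff_const

lemma IsTestFunction.partialDeriv (i : Fin N) {φ : RN N → ℝ} (h : IsTestFunction φ) :
    IsTestFunction (partialDeriv i φ) :=
  ⟨contDiff_partialDeriv i h.1, (h.2.fderiv ℝ).comp_left (g := fun L : RN N →L[ℝ] ℝ =>
    L (EuclideanSpace.single i 1)) (by simp)⟩

lemma IsTestFunction.mul_left {φ f : RN N → ℝ} (h : IsTestFunction φ) (hf : ContDiff ℝ ∞ f) :
    IsTestFunction (fun x => f x * φ x) :=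
  ⟨hf.mul h.1, h.2.mul_left⟩

lemma IsTestFunction.mul_right {φ f : RN N → ℝ} (h : IsTestFunction φ) (hf : ContDiff ℝ ∞ f) :
    IsTestFunction (fun x => φ x * f x) :=
  ⟨h.1.mul hf, h.2.mul_right⟩

lemma IsTestFunction.integrable_mul {φ f : RN N → ℝ} (h : IsTestFunction φ)
    (hf : LocallyIntegrable f) : Integrable (fun x => f x * φ x) := by
  simpa only [smul_eq_mul, mul_comm] using
    hf.integrable_smul_left_of_hasCompactSupport h.continuous h.2

lemma partialDeriv_mul (i : Fin N) {f g : RN N → ℝ} {x : RN N} (hf : DifferentiableAt ℝ f x)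
    (hg : DifferentiableAt ℝ g x) : partialDeriv i (fun y => f y * g y) x =
      partialDeriv i f x * g x + f x * partialDeriv i g x := by
  rw [partialDeriv, fderiv_fun_mul hf hg]
  simp [partialDeriv]
  ring

lemma integral_mul_partialDeriv (i : Fin N) {f φ : RN N → ℝ} (hf : ContDiff ℝ 1 f)
    (h : IsTestFunction φ) :
    ∫ x, f x * partialDeriv i φ x = -∫ x, partialDeriv i f x * φ x := by
  have hcont : Continuous (partialDeriv i f) := by
    have := hf.continuous_fderiv (by simp)
    unfold HartreeSystem.partialDeriv
    fun_prop
  exact integral_mul_fderiv_eq_neg_fderiv_mul_of_integrable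
    (h.integrable_mul hcont.locallyIntegrable)
    ((h.partialDeriv i).integrable_mul hf.continuous.locallyIntegrable)
    (h.integrable_mul hf.continuous.locallyIntegrable)
    (fun x _ => hf.differentiable (by simp) x) (fun x _ => h.differentiable x)

/-! ### Weak derivatives -/

lemma IsWeakPartial.ae_eq {i : Fin N} {u g g' : RN N → ℝ} (h : IsWeakPartial i u g)
    (h' : IsWeakPartial i u g') : g =ᵐ[volume] g' := by
  refine ae_eq_of_integral_contDiff_smul_eq h.2.1 h'.2.1 fun φ h1 h2 => ?_
  have e1 := h.2.2 φ ⟨h1, h2⟩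
  have e2 := h'.2.2 φ ⟨h1, h2⟩
  simp only [smul_eq_mul, mul_comm (φ _)]
  linarith

lemma locallyIntegrable_congr_ae {f g : RN N → ℝ} (hf : LocallyIntegrable f)
    (h : f =ᵐ[volume] g) : LocallyIntegrable g := fun x =>
  (hf x).imp fun _ hs => ⟨hs.1, hs.2.congr (ae_restrict_of_ae h)⟩

lemma IsWeakPartial.congr {i : Fin N} {u g u' g' : RN N → ℝ} (h : IsWeakPartial i u g)
    (hu : u =ᵐ[volume] u') (hg : g =ᵐ[volume] g') : IsWeakPartial i u' g' := by
  refine ⟨locallyIntegrable_congr_ae h.1 hu, locallyIntegrable_congr_ae h.2.1 hg,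
    fun φ hφ => ?_⟩
  have h1 := integral_congr_ae (hu.mul (ae_eq_refl (partialDeriv i φ)))
  have h2 := integral_congr_ae (hg.mul (ae_eq_refl φ))
  simp only [Pi.mul_apply] at h1 h2
  rw [← h1, ← h2]
  exact h.2.2 φ hφ

/-! ### Passing to the limit in pairings with mollified functions -/

/-- The pairing with `R` is bounded by `C` on `L^r`. -/
def PairingBound (r : ℝ) (C : ℝ≥0) (R : RN N → ℝ) : Prop :=
  AEStronglyMeasurable R ∧ ∀ w : RN N → ℝ, AEStronglyMeasurable w →
    ∫⁻ x, ‖R x‖ₑ * ‖w x‖ₑ ≤ C * eLpNorm w (ENNReal.ofReal r)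

lemma pairingBound_of_bounded {R : RN N → ℝ} (hR : AEStronglyMeasurable R) {C : ℝ≥0}
    (hC : ∀ x, |R x| ≤ C) : PairingBound 1 C R := by
  refine ⟨hR, fun w hw => ?_⟩
  rw [ENNReal.ofReal_one, eLpNorm_one_eq_lintegral_enorm, ← lintegral_const_mul'' _ hw.enorm]
  refine lintegral_mono fun x => mul_le_mul_left ?_ _
  rw [← ofReal_norm, Real.norm_eq_abs]
  exact ENNReal.ofReal_le_of_le_toReal (by simpa using hC x)

lemma exists_pairingBound_two {R : RN N → ℝ} (hR : MemLp R 2) : ∃ C, PairingBound 2 C R := by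
  refine ⟨(eLpNorm R 2).toNNReal, hR.1, fun w hw => ?_⟩
  rw [ENNReal.coe_toNNReal hR.2.ne]
  have := ENNReal.lintegral_mul_le_Lp_mul_Lq volume Real.HolderConjugate.two_two hR.1.enorm hw.enorm
  refine this.trans (le_of_eq ?_)
  rw [show ENNReal.ofReal 2 = 2 by simp, eLpNorm_eq_lintegral_rpow_enorm_toReal (by simp) (by simp),
    eLpNorm_eq_lintegral_rpow_enorm_toReal (by simp) (by simp)]
  simp

lemma eLpNorm_mul_test_le {ψ : RN N → ℝ} (hψ : Continuous ψ) (hψs : HasCompactSupport ψ) :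
    ∃ B : ℝ≥0, ∀ (r : ℝ≥0∞) (w : RN N → ℝ),
      eLpNorm (fun x => ψ x * w x) r ≤ B * eLpNorm w r (volume.restrict (tsupport ψ)) := by
  obtain ⟨B, hB⟩ := hψ.bounded_above_of_compact_support hψs
  refine ⟨|B|.toNNReal, fun r w => ?_⟩
  have hK : MeasurableSet (tsupport ψ) := (isClosed_tsupport ψ).measurableSet
  rw [← eLpNorm_indicator_eq_eLpNorm_restrict hK]
  refine eLpNorm_le_nnreal_smul_eLpNorm_of_ae_le_mul (Eventually.of_forall fun x => ?_) r
  rw [← NNReal.coe_le_coe, NNReal.coe_mul, coe_nnnorm, coe_nnnorm, Real.coe_toNNReal _ (abs_nonneg B)]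
  by_cases hx : x ∈ tsupport ψ
  · rw [indicator_of_mem hx, norm_mul]
    exact mul_le_mul_of_nonneg_right ((hB x).trans (le_abs_self B)) (norm_nonneg _)
  · rw [image_eq_zero_of_notMem_tsupport hx, zero_mul, norm_zero]
    positivity

lemma PairingBound.integrable {r : ℝ} {C : ℝ≥0} {R ψ f : RN N → ℝ} (hR : PairingBound r C R)
    (hψ : Continuous ψ) (hψs : HasCompactSupport ψ) (hf : MemLpLoc (ENNReal.ofReal r) f) :
    Integrable (fun x => R x * (ψ x * f x)) := by
  obtain ⟨B, hB⟩ := eLpNorm_mul_test_le hψ hψs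
  have hm : AEStronglyMeasurable (fun x => ψ x * f x) :=
    hψ.aestronglyMeasurable.mul hf.aestronglyMeasurable
  refine ⟨hR.1.mul hm, ?_⟩
  rw [HasFiniteIntegral]
  simp_rw [enorm_mul (R _)]
  refine (hR.2 _ hm).trans_lt (ENNReal.mul_lt_top ENNReal.coe_lt_top ((hB _ f).trans_lt ?_))
  exact ENNReal.mul_lt_top ENNReal.coe_lt_top (hf _ hψs).2

lemma memLpLoc_of_continuous {f : RN N → ℝ} (hf : Continuous f) (r : ℝ≥0∞) : MemLpLoc r f := by
  intro K hK
  have : IsFiniteMeasure (volume.restrict K) := ⟨by simpa using hK.measure_lt_top⟩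
  obtain ⟨B, hB⟩ := hK.exists_bound_of_continuousOn hf.continuousOn
  exact MemLp.of_bound hf.aestronglyMeasurable B ((ae_restrict_mem hK.measurableSet).mono hB)

/-- The factor `R n` may vary with n as long as its bound is uniform. The chain rule needs this,
because there the factor itself depends on the mollified function. -/
lemma tendsto_integral_pairing_mollify_sub {r : ℝ} (hr : 1 ≤ r) {C : ℝ≥0} {R : ℕ → RN N → ℝ}
    {ψ f : RN N → ℝ} (hR : ∀ n, PairingBound r C (R n)) (hψ : Continuous ψ)
    (hψs : HasCompactSupport ψ) (hf : MemLpLoc (ENNReal.ofReal r) f) :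
    Tendsto (fun n => ∫ x, R n x * (ψ x * (mollify n f - f) x)) atTop (𝓝 0) := by
  obtain ⟨B, hB⟩ := eLpNorm_mul_test_le hψ hψs
  have hlf := hf.locallyIntegrable (by simpa using hr)
  rw [tendsto_zero_iff_norm_tendsto_zero]
  have hlim : Tendsto (fun n => (C : ℝ≥0∞) * (B * eLpNorm (mollify n f - f) (ENNReal.ofReal r)
      (volume.restrict (tsupport ψ)))) atTop (𝓝 0) := by
    have h1 := tendsto_eLpNorm_mollify_sub hr hf (K := tsupport ψ) hψs
    have h2 := ENNReal.Tendsto.const_mul (a := (B : ℝ≥0∞)) h1 (Or.inr ENNReal.coe_ne_top)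
    have h3 := ENNReal.Tendsto.const_mul (a := (C : ℝ≥0∞)) h2 (Or.inr ENNReal.coe_ne_top)
    simpa using h3
  have hle : ∀ n, ‖∫ x, R n x * (ψ x * (mollify n f - f) x)‖ₑ ≤ (C : ℝ≥0∞) *
      (B * eLpNorm (mollify n f - f) (ENNReal.ofReal r) (volume.restrict (tsupport ψ))) := by
    intro n
    refine (enorm_integral_le_lintegral_enorm _).trans ?_
    simp_rw [enorm_mul (R _ _)]
    refine ((hR n).2 _ ?_).trans (by gcongr; exact hB _ _)
    exact hψ.aestronglyMeasurable.mul
      ((contDiff_mollify n hlf).continuous.aestronglyMeasurable.sub hf.aestronglyMeasurable)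
  have h0 := tendsto_of_tendsto_of_tendsto_of_le_of_le tendsto_const_nhds hlim
    (fun _ => zero_le) hle
  have := (ENNReal.tendsto_toReal ENNReal.zero_ne_top).comp h0
  rw [ENNReal.toReal_zero] at this
  exact this.congr fun n => toReal_enorm _

lemma tendsto_integral_pairing_mollify {r : ℝ} (hr : 1 ≤ r) {C : ℝ≥0} {R ψ f : RN N → ℝ}
    (hR : PairingBound r C R) (hψ : Continuous ψ)
    (hψs : HasCompactSupport ψ) (hf : MemLpLoc (ENNReal.ofReal r) f) :
    Tendsto (fun n => ∫ x, R x * (ψ x * mollify n f x)) atTop (𝓝 (∫ x, R x * (ψ x * f x))) := by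
  have h1 := tendsto_integral_pairing_mollify_sub hr (fun _ => hR) hψ hψs hf
  have hlf := hf.locallyIntegrable (by simpa using hr)
  have h2 := h1.add_const (∫ x, R x * (ψ x * f x))
  rw [zero_add] at h2
  refine h2.congr fun n => ?_
  rw [← integral_add]
  · refine integral_congr_ae (Eventually.of_forall fun x => ?_)
    simp only [Pi.sub_apply]
    ring
  · have hc := (contDiff_mollify n hlf).continuous
    refine (hR.integrable hψ hψs (memLpLoc_of_continuous hc _)).sub
      (hR.integrable hψ hψs hf) |>.congr (Eventually.of_forall fun x => ?_)
    simp only [Pi.sub_apply]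
    ring
  · exact hR.integrable hψ hψs hf

/-! ### Chain rules -/

lemma partialDeriv_comp {Φ : ℝ → ℝ} {d : ℝ} (i : Fin N) {f : RN N → ℝ} {x : RN N}
    (hΦ : HasDerivAt Φ d (f x)) (hf : DifferentiableAt ℝ f x) :
    partialDeriv i (fun y => Φ (f y)) x = d * partialDeriv i f x := by
  have h : HasFDerivAt (fun y => Φ (f y)) (d • fderiv ℝ f x) x :=
    hΦ.comp_hasFDerivAt x hf.hasFDerivAt
  rw [partialDeriv, h.fderiv]
  simp [partialDeriv]

/-- The chain rule for weak derivatives and `C^1` functions with bounded derivative. -/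
lemma integral_comp_mul_partialDeriv {i : Fin N} {f g : RN N → ℝ} (h : IsWeakPartial i f g)
    {Φ Φ' : ℝ → ℝ} (hΦ : ∀ t, HasDerivAt Φ (Φ' t) t) (hc : Continuous Φ') {M : ℝ≥0}
    (hM : ∀ t, |Φ' t| ≤ M) {ψ : RN N → ℝ} (hψ : IsTestFunction ψ) :
    ∫ x, Φ (f x) * partialDeriv i ψ x = -∫ x, Φ' (f x) * g x * ψ x := by
  obtain ⟨hf, hg, -⟩ := id h
  have hΦ1 : ContDiff ℝ 1 Φ := by
    rw [contDiff_one_iff_deriv]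
    exact ⟨fun t => (hΦ t).differentiableAt, by rwa [funext fun t => (hΦ t).deriv]⟩
  have hLip : ∀ s t, |Φ s - Φ t| ≤ M * |s - t| := fun s t => by
    have := Convex.norm_image_sub_le_of_norm_hasDerivWithin_le (f := Φ) (f' := Φ') (C := M)
      (s := univ) (x := t) (y := s) (fun x _ => (hΦ x).hasDerivWithinAt) (fun x _ => hM x)
      convex_univ (mem_univ _) (mem_univ _)
    simpa using this
  have hfm := hf.aestronglyMeasurable
  have hΦf : LocallyIntegrable fun x => Φ (f x) := by
    have h1 : LocallyIntegrable fun x => |Φ 0| + M * |f x| :=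
      (locallyIntegrable_const _).add ((locallyIntegrable_iff.2 fun K hK =>
        (hf.integrableOn_isCompact hK).norm).smul (M : ℝ))
    refine h1.mono (hΦ1.continuous.comp_aestronglyMeasurable hfm) (Eventually.of_forall fun x => ?_)
    rw [Real.norm_eq_abs, Real.norm_of_nonneg (by positivity)]
    have h2 := hLip (f x) 0
    rw [sub_zero] at h2
    have h3 := abs_sub_abs_le_abs_sub (Φ (f x)) (Φ 0)
    linarith
  set fn : ℕ → RN N → ℝ := fun n => mollify n f with hfn
  set gn : ℕ → RN N → ℝ := fun n => mollify n g with hgn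
  have hfns : ∀ n, ContDiff ℝ ∞ (fn n) := fun n => contDiff_mollify n hf
  have hgns : ∀ n, ContDiff ℝ ∞ (gn n) := fun n => contDiff_mollify n hg
  have heq : ∀ n, ∫ x, Φ (fn n x) * partialDeriv i ψ x = -∫ x, Φ' (fn n x) * gn n x * ψ x := by
    intro n
    refine (integral_mul_partialDeriv i (hΦ1.comp ((hfns n).of_le (by simp))) hψ).trans ?_
    congr 1
    refine integral_congr_ae (Eventually.of_forall fun x => ?_)
    change partialDeriv i (fun y => Φ (fn n y)) x * ψ x = _
    rw [partialDeriv_comp i (hΦ _) ((hfns n).differentiable (by simp) x)]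
    simp only [hfn, hgn, partialDeriv_mollify i n h]
  have hf1 : MemLpLoc (ENNReal.ofReal 1) f := by
    rw [ENNReal.ofReal_one]; exact LocallyIntegrable.memLpLoc hf
  have hg1 : MemLpLoc (ENNReal.ofReal 1) g := by
    rw [ENNReal.ofReal_one]; exact LocallyIntegrable.memLpLoc hg
  have hψ' := hψ.partialDeriv i
  have hgψ := hψ.integrable_mul hg
  have hb : ∀ n, PairingBound 1 M (fun x => Φ' (fn n x)) := fun n =>
    pairingBound_of_bounded (hc.comp (hfns n).continuous).aestronglyMeasurable fun x => hM _
  have L1 : Tendsto (fun n => ∫ x, Φ (fn n x) * partialDeriv i ψ x) atTop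
      (𝓝 (∫ x, Φ (f x) * partialDeriv i ψ x)) := by
    have h0 : Tendsto (fun n => ∫ x, (Φ (fn n x) - Φ (f x)) * partialDeriv i ψ x) atTop (𝓝 0) := by
      -- The difference quotient is bounded by the Lipschitz constant M, and multiplied by `fn n -
      -- f` it recovers the difference of the values of Φ. Where `fn n x = f x` both sides vanish,
      -- division by zero being zero.
      set R : ℕ → RN N → ℝ := fun n x => (Φ (fn n x) - Φ (f x)) / (fn n x - f x) with hRd
      have hR : ∀ n, PairingBound 1 M (R n) := fun n => by
        refine pairingBound_of_bounded ?_ fun x => ?_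
        · have m1 := (hΦ1.continuous.comp (hfns n).continuous).aestronglyMeasurable (μ := volume)
          have m2 := hΦ1.continuous.comp_aestronglyMeasurable hfm
          exact (m1.sub m2).div₀ ((hfns n).continuous.aestronglyMeasurable.sub hfm)
        · rw [hRd, abs_div]
          rcases eq_or_ne (fn n x - f x) 0 with h0 | h0
          · simp [h0]
          · rw [div_le_iff₀ (abs_pos.2 h0)]
            exact hLip _ _
      refine (tendsto_integral_pairing_mollify_sub le_rfl hR hψ'.continuous hψ'.2 hf1).congr
        fun n => integral_congr_ae (Eventually.of_forall fun x => ?_)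
      simp only [hRd, Pi.sub_apply]
      change (Φ (fn n x) - Φ (f x)) / (fn n x - f x) * (_ * (fn n x - f x)) = _
      rcases eq_or_ne (fn n x - f x) 0 with h0 | h0
      · rw [sub_eq_zero] at h0
        simp [h0]
      · field_simp
    have h2 := h0.add_const (∫ x, Φ (f x) * partialDeriv i ψ x)
    rw [zero_add] at h2
    refine h2.congr fun n => ?_
    have i1 := hψ'.integrable_mul hΦf
    have i2 := hψ'.integrable_mul (hΦ1.continuous.comp (hfns n).continuous).locallyIntegrable
    rw [← integral_add _ i1]
    · refine integral_congr_ae (Eventually.of_forall fun x => ?_)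
      simp only
      ring
    · refine (i2.sub i1).congr (Eventually.of_forall fun x => ?_)
      simp only [Pi.sub_apply, Function.comp]
      ring
  have L2 : Tendsto (fun n => ∫ x, Φ' (fn n x) * gn n x * ψ x) atTop
      (𝓝 (∫ x, Φ' (f x) * g x * ψ x)) := by
    -- The product is split as Φ'(f_n)(g_n - g) + Φ'(f_n) g. The first term is a uniformly bounded
    -- pairing with a mollification error, the second converges by domination since f_n → f almost
    -- everywhere.
    have h1 := tendsto_integral_pairing_mollify_sub le_rfl hb hψ.continuous hψ.2 hg1
    have h2 : Tendsto (fun n => ∫ x, Φ' (fn n x) * (g x * ψ x)) atTop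
        (𝓝 (∫ x, Φ' (f x) * (g x * ψ x))) := by
      refine tendsto_integral_of_dominated_convergence (fun x => M * ‖g x * ψ x‖) (fun n => ?_)
        (hgψ.norm.const_mul _) (fun n => Eventually.of_forall fun x => ?_) ?_
      · exact (hb n).1.mul hgψ.1
      · rw [norm_mul]
        exact mul_le_mul_of_nonneg_right (hM _) (norm_nonneg _)
      · filter_upwards [ae_tendsto_mollify hf] with x hx
        exact ((hc.tendsto _).comp hx).mul_const _
    have h3 := h1.add h2
    rw [zero_add] at h3
    simp_rw [mul_assoc]
    refine h3.congr fun n => ?_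
    rw [← integral_add]
    · refine integral_congr_ae (Eventually.of_forall fun x => ?_)
      simp only [hgn, Pi.sub_apply]
      ring
    · refine ((hb n).integrable hψ.continuous hψ.2
        (memLpLoc_of_continuous (hgns n).continuous _)).sub ((hb n).integrable hψ.continuous hψ.2 hg1)
        |>.congr (Eventually.of_forall fun x => ?_)
      simp only [hgn, Pi.sub_apply]
      ring
    · exact hgψ.bdd_mul (hb n).1 (c := M) (Eventually.of_forall fun x => hM _)
  have L3 := L1.congr heq
  exact tendsto_nhds_unique L3 L2.neg

/-! ### Truncated powers and the weak derivative of `|f| ^ p`. -/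

/-- The derivative of `|t| ^ p`. -/
def powDeriv (p t : ℝ) : ℝ := p * (|t| ^ (p - 2) * t)

lemma hasDerivAt_abs_rpow' {p : ℝ} (hp : 1 < p) (t : ℝ) :
    HasDerivAt (fun t => |t| ^ p) (powDeriv p t) t := by
  rw [powDeriv, ← mul_assoc]
  exact hasDerivAt_abs_rpow t hp

lemma continuous_powDeriv {p : ℝ} (hp : 1 < p) : Continuous (powDeriv p) := by
  have h := (contDiff_norm_rpow (E := ℝ) hp).continuous_deriv le_rfl
  refine h.congr fun t => ?_
  exact (hasDerivAt_abs_rpow' hp t).deriv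

lemma abs_rpow_sub_two_mul {p : ℝ} (hp : 1 < p) (t : ℝ) : |(|t| ^ (p - 2) * t)| = |t| ^ (p - 1) := by
  rw [abs_mul, abs_of_nonneg (by positivity)]
  rcases eq_or_ne t 0 with rfl | ht
  · simp [Real.zero_rpow (by linarith : p - 1 ≠ 0)]
  · have : 0 < |t| := abs_pos.2 ht
    nth_rewrite 2 [← Real.rpow_one |t|]
    rw [← Real.rpow_add this]
    ring_nf

lemma abs_powDeriv {p : ℝ} (hp : 1 < p) (t : ℝ) : |powDeriv p t| = p * |t| ^ (p - 1) := by
  rw [powDeriv, abs_mul, abs_of_pos (by linarith), abs_rpow_sub_two_mul hp]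

/-- A crude Young inequality: replacing the smaller of a and b by the larger one turns the product
into a single p-th power. -/
lemma rpow_sub_one_mul_le {p a b : ℝ} (hp : 1 < p) (ha : 0 ≤ a) (hb : 0 ≤ b) :
    a ^ (p - 1) * b ≤ a ^ p + b ^ p := by
  have key : ∀ c : ℝ, 0 ≤ c → c ^ (p - 1) * c = c ^ p := fun c hc => by
    nth_rewrite 2 [← Real.rpow_one c]
    rw [← Real.rpow_add' hc (by linarith), sub_add_cancel]
  rcases le_total a b with h | h
  · calc a ^ (p - 1) * b ≤ b ^ (p - 1) * b := by gcongr
      _ = b ^ p := key b hb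
      _ ≤ _ := le_add_of_nonneg_left (by positivity)
  · calc a ^ (p - 1) * b ≤ a ^ (p - 1) * a := by gcongr
      _ = a ^ p := key a ha
      _ ≤ _ := le_add_of_nonneg_right (by positivity)

lemma MemLpLoc.locallyIntegrable_abs_rpow {p : ℝ} (hp : 1 < p) {f : RN N → ℝ}
    (hf : MemLpLoc (ENNReal.ofReal p) f) : LocallyIntegrable fun x => |f x| ^ p := by
  rw [locallyIntegrable_iff]
  intro K hK
  have := (hf K hK).integrable_norm_rpow (by simpa using by linarith) (by simp)
  rwa [ENNReal.toReal_ofReal (by linarith)] at this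

lemma MemLpLoc.locallyIntegrable_rpow_mul {p : ℝ} (hp : 1 < p) {f g : RN N → ℝ}
    (hf : MemLpLoc (ENNReal.ofReal p) f) (hg : MemLpLoc (ENNReal.ofReal p) g) :
    LocallyIntegrable fun x => |f x| ^ (p - 1) * |g x| := by
  have hpm : Continuous fun t : ℝ => |t| ^ (p - 1) := by
    have : 0 ≤ p - 1 := by linarith
    fun_prop (disch := assumption)
  refine ((hf.locallyIntegrable_abs_rpow hp).add (hg.locallyIntegrable_abs_rpow hp)).mono
    ((hpm.comp_aestronglyMeasurable hf.aestronglyMeasurable).mul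
      (continuous_abs.comp_aestronglyMeasurable hg.aestronglyMeasurable))
    (Eventually.of_forall fun x => ?_)
  rw [Real.norm_of_nonneg (by positivity)]
  exact (rpow_sub_one_mul_le hp (abs_nonneg _) (abs_nonneg _)).trans (le_abs_self _)

/-- The derivative of `|t| ^ p`, frozen outside `[-k, k]`. -/
def truncPowDeriv (p : ℝ) (k : ℕ) (t : ℝ) : ℝ := powDeriv p (max (-k) (min k t))

lemma abs_clamp_le (k : ℕ) (t : ℝ) : |max (-(k : ℝ)) (min k t)| ≤ |t| := by
  have hk : (0 : ℝ) ≤ k := Nat.cast_nonneg k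
  rw [abs_le]
  constructor
  · refine le_max_of_le_right (le_min (by linarith [abs_nonneg t]) (neg_abs_le t))
  · refine max_le (by linarith [abs_nonneg t]) ((min_le_right _ _).trans (le_abs_self t))

lemma clamp_eq {k : ℕ} {t : ℝ} (h : |t| ≤ k) : max (-(k : ℝ)) (min k t) = t := by
  rw [abs_le] at h
  rw [min_eq_right h.2, max_eq_right h.1]

lemma continuous_truncPowDeriv {p : ℝ} (hp : 1 < p) (k : ℕ) : Continuous (truncPowDeriv p k) :=
  (continuous_powDeriv hp).comp (by fun_prop)

lemma abs_truncPowDeriv_le {p : ℝ} (hp : 1 < p) (k : ℕ) (t : ℝ) :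
    |truncPowDeriv p k t| ≤ p * |t| ^ (p - 1) := by
  rw [truncPowDeriv, abs_powDeriv hp]
  exact mul_le_mul_of_nonneg_left
    (Real.rpow_le_rpow (abs_nonneg _) (abs_clamp_le k t) (by linarith)) (by linarith)

lemma abs_truncPowDeriv_le' {p : ℝ} (hp : 1 < p) (k : ℕ) (t : ℝ) :
    |truncPowDeriv p k t| ≤ p * (k : ℝ) ^ (p - 1) := by
  rw [truncPowDeriv, abs_powDeriv hp]
  have hk : (0 : ℝ) ≤ k := Nat.cast_nonneg k
  exact mul_le_mul_of_nonneg_left (Real.rpow_le_rpow (abs_nonneg _)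
    (abs_le.2 ⟨le_max_left _ _, max_le (by linarith) (min_le_left _ _)⟩) (by linarith))
    (by linarith)

/-- A primitive of `truncPowDeriv`. -/
def truncPow (p : ℝ) (k : ℕ) (t : ℝ) : ℝ := ∫ s in (0 : ℝ)..t, truncPowDeriv p k s

/-- The constant p is not sharp; a bound uniform in k is all that domination needs. -/
lemma abs_truncPow_le {p : ℝ} (hp : 1 < p) (k : ℕ) (t : ℝ) : |truncPow p k t| ≤ p * |t| ^ p := by
  have h := intervalIntegral.norm_integral_le_of_norm_le_const (a := 0) (b := t)
    (f := truncPowDeriv p k) (C := p * |t| ^ (p - 1)) fun s hs => by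
      refine (abs_truncPowDeriv_le hp k s).trans ?_
      have : |s| ≤ |t| := by
        rw [mem_uIoc] at hs
        rcases hs with hs | hs
        · rw [abs_of_pos hs.1, abs_of_pos (hs.1.trans_le hs.2)]; exact hs.2
        · rw [abs_of_nonpos hs.2, abs_of_neg (hs.1.trans_le hs.2)]; linarith [hs.1]
      gcongr
  rw [sub_zero, Real.norm_eq_abs] at h
  refine h.trans (le_of_eq ?_)
  rw [mul_assoc]
  congr 1
  nth_rewrite 2 [← Real.rpow_one |t|]
  rw [← Real.rpow_add' (abs_nonneg t) (by linarith), sub_add_cancel]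

lemma truncPow_eq {p : ℝ} (hp : 1 < p) {k : ℕ} {t : ℝ} (h : |t| ≤ k) : truncPow p k t = |t| ^ p := by
  have h1 : truncPow p k t = ∫ s in (0 : ℝ)..t, powDeriv p s := by
    refine intervalIntegral.integral_congr fun s hs => ?_
    rw [truncPowDeriv, clamp_eq]
    refine le_trans ?_ h
    simpa using abs_sub_left_of_mem_uIcc hs
  rw [h1, intervalIntegral.integral_eq_sub_of_hasDerivAt (fun s _ => hasDerivAt_abs_rpow' hp s)
    ((continuous_powDeriv hp).intervalIntegrable _ _)]
  simp [Real.zero_rpow (by linarith : p ≠ 0)]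

/-- The chain rule for the weak derivative of `|f| ^ p`. -/
theorem IsWeakPartial.abs_rpow {i : Fin N} {p : ℝ} (hp : 1 < p) {f g : RN N → ℝ}
    (h : IsWeakPartial i f g) (hf : MemLpLoc (ENNReal.ofReal p) f)
    (hg : MemLpLoc (ENNReal.ofReal p) g) :
    IsWeakPartial i (fun x => |f x| ^ p) (fun x => powDeriv p (f x) * g x) := by
  have hI1 := hf.locallyIntegrable_abs_rpow hp
  have hI2 := hf.locallyIntegrable_rpow_mul hp hg
  have hfm := hf.aestronglyMeasurable
  have hgm := hg.aestronglyMeasurable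
  have hp0 : 0 ≤ p := by linarith
  refine ⟨hI1, (hI2.smul p).mono
    (((continuous_powDeriv hp).comp_aestronglyMeasurable hfm).mul hgm)
    (Eventually.of_forall fun x => ?_), fun ψ hψ => ?_⟩
  · rw [norm_mul, Real.norm_eq_abs, abs_powDeriv hp, Pi.smul_apply, norm_smul,
      Real.norm_of_nonneg hp0, norm_mul, Real.norm_eq_abs |g x|, abs_abs, Real.norm_eq_abs (g x),
      Real.norm_of_nonneg (by positivity : 0 ≤ |f x| ^ (p - 1)), mul_assoc]
  have hd : ∀ k t, HasDerivAt (truncPow p k) (truncPowDeriv p k t) t := fun k t =>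
    (continuous_truncPowDeriv hp k).integral_hasStrictDerivAt 0 t |>.hasDerivAt
  -- The derivative of |t|^p is unbounded, so the C¹ chain rule is applied to the truncations. For
  -- each x the integrands are eventually constant in k, and the bounds do not depend on k, so
  -- dominated convergence removes the truncation.
  have heq : ∀ k : ℕ, _ := fun k => integral_comp_mul_partialDeriv h (hd k)
    (continuous_truncPowDeriv hp k) (M := (p * (k : ℝ) ^ (p - 1)).toNNReal)
    (fun t => (abs_truncPowDeriv_le' hp k t).trans (Real.le_coe_toNNReal _)) hψ
  have hψ' := hψ.partialDeriv i
  have hev : ∀ x, ∀ᶠ k : ℕ in atTop, |f x| ≤ k := fun x => by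
    filter_upwards [eventually_ge_atTop ⌈|f x|⌉₊] with k hk using Nat.ceil_le.1 hk
  have L1 : Tendsto (fun k => ∫ x, truncPow p k (f x) * partialDeriv i ψ x) atTop
      (𝓝 (∫ x, |f x| ^ p * partialDeriv i ψ x)) := by
    refine tendsto_integral_of_dominated_convergence
      (fun x => p * ‖|f x| ^ p * partialDeriv i ψ x‖) (fun k => ?_)
      ((hψ'.integrable_mul hI1).norm.const_mul _) (fun k => Eventually.of_forall fun x => ?_)
      (Eventually.of_forall fun x => ?_)
    · have : Continuous (truncPow p k) :=
        continuous_iff_continuousAt.2 fun t => (hd k t).continuousAt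
      exact (this.comp_aestronglyMeasurable hfm).mul hψ'.continuous.aestronglyMeasurable
    · rw [norm_mul, norm_mul, ← mul_assoc, Real.norm_of_nonneg (by positivity : 0 ≤ |f x| ^ p)]
      exact mul_le_mul_of_nonneg_right (abs_truncPow_le hp k _) (norm_nonneg _)
    · refine tendsto_const_nhds.congr' ?_
      filter_upwards [hev x] with k hk
      rw [truncPow_eq hp hk]
  have L2 : Tendsto (fun k => ∫ x, truncPowDeriv p k (f x) * g x * ψ x) atTop
      (𝓝 (∫ x, powDeriv p (f x) * g x * ψ x)) := by
    refine tendsto_integral_of_dominated_convergence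
      (fun x => p * ‖|f x| ^ (p - 1) * |g x| * ψ x‖) (fun k => ?_)
      ((hψ.integrable_mul hI2).norm.const_mul _) (fun k => Eventually.of_forall fun x => ?_)
      (Eventually.of_forall fun x => ?_)
    · exact (((continuous_truncPowDeriv hp k).comp_aestronglyMeasurable hfm).mul hgm).mul
        hψ.continuous.aestronglyMeasurable
    · rw [norm_mul, norm_mul, norm_mul, norm_mul, ← mul_assoc, ← mul_assoc,
        Real.norm_of_nonneg (by positivity : 0 ≤ |f x| ^ (p - 1)), Real.norm_eq_abs |g x|, abs_abs]
      rw [Real.norm_eq_abs (g x)]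
      gcongr
      exact abs_truncPowDeriv_le hp k _
    · refine tendsto_const_nhds.congr' ?_
      filter_upwards [hev x] with k hk
      rw [truncPowDeriv, clamp_eq hk]
  exact tendsto_nhds_unique (L1.congr heq) L2.neg

/-! ### Powers in Lebesgue spaces -/

lemma memLp_abs_rpow {θ p : ℝ} (hp : 0 < p) {u : RN N → ℝ}
    (hu : MemLp u (ENNReal.ofReal (θ * p))) : MemLp (fun x => |u x| ^ p) (ENNReal.ofReal θ) := by
  have h := hu.norm_rpow_div (ENNReal.ofReal p)
  rw [← ENNReal.ofReal_div_of_pos hp, mul_div_cancel_right₀ _ hp.ne', ENNReal.toReal_ofReal hp.le] at h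
  exact h

/-- The exponent count (p-1)/(θp) + 1/(θp) = 1/θ, matching |u|^{p-1} times a function in L^{θp}. -/
lemma holderTriple_rpow {θ p : ℝ} (hθ : 1 < θ) (hp : 1 < p) :
    ENNReal.HolderTriple (ENNReal.ofReal (θ * p / (p - 1))) (ENNReal.ofReal (θ * p))
      (ENNReal.ofReal θ) := by
  have hp1 : 0 < p - 1 := by linarith
  have hθ0 : 0 < θ := by linarith
  have hp0 : 0 < p := by linarith
  constructor
  rw [← ENNReal.ofReal_inv_of_pos (by positivity), ← ENNReal.ofReal_inv_of_pos (by positivity),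
    ← ENNReal.ofReal_inv_of_pos (by positivity), ← ENNReal.ofReal_add (by positivity) (by positivity)]
  congr 1
  field_simp
  ring

lemma memLp_abs_rpow_sub_two_mul {θ p : ℝ} (hθ : 1 < θ) (hp : 1 < p) {u : RN N → ℝ}
    (hu : MemLp u (ENNReal.ofReal (θ * p))) :
    MemLp (fun x => |u x| ^ (p - 2) * u x) (ENNReal.ofReal (θ * p / (p - 1))) := by
  have hp1 : 0 < p - 1 := by linarith
  have hθ0 : 0 < θ := by linarith
  have hp0 : 0 < p := by linarith
  have h1 := memLp_abs_rpow (θ := θ * p / (p - 1)) (p := p - 1) hp1 (u := u)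
    (by rwa [div_mul_cancel₀ _ hp1.ne'])
  have hc : Continuous fun t : ℝ => |t| ^ (p - 2) * t := by
    have := (continuous_powDeriv hp).const_mul p⁻¹
    refine this.congr fun t => ?_
    rw [powDeriv, inv_mul_cancel_left₀ hp0.ne']
  refine h1.of_le (hc.comp_aestronglyMeasurable hu.1) (Eventually.of_forall fun x => ?_)
  rw [Real.norm_eq_abs, abs_rpow_sub_two_mul hp]
  exact le_abs_self _

lemma memLp_powDeriv_mul {θ p : ℝ} (hθ : 1 < θ) (hp : 1 < p) {u g : RN N → ℝ}
    (hu : MemLp u (ENNReal.ofReal (θ * p))) (hg : MemLp g (ENNReal.ofReal (θ * p))) :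
    MemLp (fun x => powDeriv p (u x) * g x) (ENNReal.ofReal θ) := by
  have := holderTriple_rpow hθ hp
  have h := (hg.mul (memLp_abs_rpow_sub_two_mul hθ hp hu) (r := ENNReal.ofReal θ)).const_mul p
  refine h.ae_eq (Eventually.of_forall fun x => ?_)
  simp only [powDeriv, Pi.mul_apply]
  ring

/-! ### The Riesz potential operator -/

/-- Exponents to which the Hardy-Littlewood-Sobolev inequality for `I_α` applies. -/
structure HLSAdmissible (N : ℕ) (α θ₁ θ₂ : ℝ) : Prop where
  dim_pos : 1 ≤ N
  pos : 0 < α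
  lt_dim : α < N
  one_lt_left : 1 < θ₁
  one_lt_right : 1 < θ₂
  scaling : 1 / θ₁ + 1 / θ₂ = (N + α) / N

lemma HLSAdmissible.symm {α θ₁ θ₂ : ℝ} (h : HLSAdmissible N α θ₁ θ₂) :
    HLSAdmissible N α θ₂ θ₁ :=
  ⟨h.dim_pos, h.pos, h.lt_dim, h.one_lt_right, h.one_lt_left, by rw [add_comm]; exact h.scaling⟩

/-- The normalizing constant of the Riesz potential. -/
def rieszConst (N : ℕ) (α : ℝ) : ℝ :=
  Real.Gamma ((N - α) / 2) / (Real.Gamma (α / 2) * Real.pi ^ ((N : ℝ) / 2) * (2 : ℝ) ^ α)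

/-- The kernel `‖z‖ ^ (-(N - α))`. -/
def normKernel (N : ℕ) (α : ℝ) (z : RN N) : ℝ := ‖z‖ ^ (-((N : ℝ) - α))

lemma rieszPotential_eq (α : ℝ) (z : RN N) :
    rieszPotential N α z = rieszConst N α * normKernel N α z := by
  rw [rieszPotential, rieszConst, normKernel, Real.rpow_neg (norm_nonneg z), one_div]

lemma normKernel_nonneg (α : ℝ) (z : RN N) : 0 ≤ normKernel N α z := by
  unfold normKernel; positivity

lemma measurable_normKernel (α : ℝ) : Measurable (normKernel N α) :=
  measurable_norm.pow_const _

lemma enorm_normKernel (α : ℝ) (z : RN N) : ‖normKernel N α z‖ₑ = powKernel N (N - α) z :=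
  Real.enorm_of_nonneg (normKernel_nonneg α z)

lemma HLSAdmissible.exists_bound {α θ₁ θ₂ : ℝ} (h : HLSAdmissible N α θ₁ θ₂) :
    ∃ C : ℝ≥0, ∀ f g : RN N → ℝ, AEStronglyMeasurable f → AEStronglyMeasurable g →
      ∫⁻ x, ∫⁻ y, ‖f x‖ₑ * (‖normKernel N α (x - y)‖ₑ * ‖g y‖ₑ) ≤
        C * (eLpNorm f (ENNReal.ofReal θ₁) * eLpNorm g (ENNReal.ofReal θ₂)) := by
  have hN0 : (0 : ℝ) < N := by exact_mod_cast h.dim_pos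
  have h1 := h.one_lt_left
  have h2 := h.one_lt_right
  -- With s = N - α the scaling relation reads 2 - s/N = (N+α)/N.
  obtain ⟨C, hC⟩ := hardy_littlewood_sobolev h.dim_pos (s := N - α) (by linarith [h.lt_dim])
    (by linarith [h.pos]) h1 h2 (by rw [h.scaling]; field_simp; ring)
  refine ⟨C, fun f g hf hg => ?_⟩
  have := hC _ _ hf.enorm hg.enorm
  simp_rw [enorm_normKernel]
  rwa [eLpNorm_eq_lintegral_rpow_enorm_toReal (by simp; linarith) (by simp),
    eLpNorm_eq_lintegral_rpow_enorm_toReal (by simp; linarith) (by simp),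
    ENNReal.toReal_ofReal (by linarith), ENNReal.toReal_ofReal (by linarith)]

/-- Kernels dominated by `I_α` give absolutely convergent double integrals. -/
lemma HLSAdmissible.integrable_of_le {α θ₁ θ₂ : ℝ} (h : HLSAdmissible N α θ₁ θ₂)
    {f g : RN N → ℝ} (hf : MemLp f (ENNReal.ofReal θ₁)) (hg : MemLp g (ENNReal.ofReal θ₂))
    {m : RN N × RN N → ℝ} (hm : AEStronglyMeasurable m (volume.prod volume)) {B : ℝ}
    (hB : ∀ᵐ z ∂volume.prod volume, |m z| ≤ B * normKernel N α (z.1 - z.2)) :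
    Integrable (fun z : RN N × RN N => m z * (f z.1 * g z.2)) (volume.prod volume) := by
  obtain ⟨C, hC⟩ := h.exists_bound
  have hk : Measurable fun z : RN N × RN N => normKernel N α (z.1 - z.2) :=
    (measurable_normKernel α).comp (measurable_fst.sub measurable_snd)
  have hfg : AEStronglyMeasurable (fun z : RN N × RN N => f z.1 * g z.2) (volume.prod volume) :=
    hf.1.comp_fst.mul hg.1.comp_snd
  have hI : Integrable (fun z : RN N × RN N => normKernel N α (z.1 - z.2) * (f z.1 * g z.2))
      (volume.prod volume) := by
    refine ⟨hk.aestronglyMeasurable.mul hfg, ?_⟩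
    rw [HasFiniteIntegral]
    refine (lintegral_prod _ (hk.aestronglyMeasurable.mul hfg).enorm).trans_lt ?_
    refine lt_of_eq_of_lt ?_ ((hC f g hf.1 hg.1).trans_lt
      (ENNReal.mul_lt_top ENNReal.coe_lt_top (ENNReal.mul_lt_top hf.2 hg.2)))
    refine lintegral_congr fun x => lintegral_congr fun y => ?_
    simp only [Pi.mul_apply, enorm_mul]
    ring
  refine (hI.norm.const_mul B).mono' (hm.mul hfg) ?_
  filter_upwards [hB] with z hz
  rw [norm_mul, norm_mul (normKernel _ _ _), Real.norm_of_nonneg (normKernel_nonneg _ _),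
    ← mul_assoc]
  exact mul_le_mul_of_nonneg_right hz (norm_nonneg _)

lemma measurable_normKernel_sub (α : ℝ) :
    Measurable fun z : RN N × RN N => normKernel N α (z.1 - z.2) :=
  (measurable_normKernel α).comp (measurable_fst.sub measurable_snd)

lemma HLSAdmissible.integrable {α θ₁ θ₂ : ℝ} (h : HLSAdmissible N α θ₁ θ₂)
    {f g : RN N → ℝ} (hf : MemLp f (ENNReal.ofReal θ₁)) (hg : MemLp g (ENNReal.ofReal θ₂)) :
    Integrable (fun z : RN N × RN N => normKernel N α (z.1 - z.2) * (f z.1 * g z.2))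
      (volume.prod volume) :=
  h.integrable_of_le hf hg (measurable_normKernel_sub α).aestronglyMeasurable (B := 1)
    (Eventually.of_forall fun z => by rw [one_mul, abs_of_nonneg (normKernel_nonneg _ _)])

lemma rieszConv_apply (α : ℝ) (g : RN N → ℝ) (x : RN N) :
    rieszConv α g x = rieszConst N α * ∫ y, normKernel N α (x - y) * g y := by
  rw [rieszConv, convolution_eq_swap, ← integral_const_mul]
  simp [rieszPotential_eq, mul_assoc]

lemma HLSAdmissible.integral_rieszConv_mul {α θ₁ θ₂ : ℝ} (h : HLSAdmissible N α θ₁ θ₂)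
    {f g : RN N → ℝ} (hf : MemLp f (ENNReal.ofReal θ₁)) (hg : MemLp g (ENNReal.ofReal θ₂)) :
    ∫ x, rieszConv α g x * f x = rieszConst N α *
      ∫ z : RN N × RN N, normKernel N α (z.1 - z.2) * (f z.1 * g z.2) ∂volume.prod volume := by
  rw [integral_prod _ (h.integrable hf hg), ← integral_const_mul]
  refine integral_congr_ae (Eventually.of_forall fun x => ?_)
  simp only [rieszConv_apply]
  rw [mul_assoc, ← integral_mul_const]
  congr 1
  refine integral_congr_ae (Eventually.of_forall fun y => ?_)
  simp only
  ring

lemma aestronglyMeasurable_rieszConv (α : ℝ) {g : RN N → ℝ} (hg : AEStronglyMeasurable g) :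
    AEStronglyMeasurable (rieszConv α g) := by
  have h1 : AEStronglyMeasurable (fun z : RN N × RN N => normKernel N α (z.1 - z.2) * g z.2)
      (volume.prod volume) := (measurable_normKernel_sub α).aestronglyMeasurable.mul hg.comp_snd
  have h2 := h1.integral_prod_right'.const_mul (rieszConst N α)
  exact h2.congr (Eventually.of_forall fun x => (rieszConv_apply α g x).symm)

/-- The right-hand side of the Hartree equation acts boundedly on `L^{θ₁ p}`. -/
lemma HLSAdmissible.exists_pairingBound {α θ₁ θ₂ : ℝ} (h : HLSAdmissible N α θ₁ θ₂) {p : ℝ}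
    (hp : 1 < p) {u g : RN N → ℝ} (hu : MemLp u (ENNReal.ofReal (θ₁ * p)))
    (hg : MemLp g (ENNReal.ofReal θ₂)) :
    ∃ C, PairingBound (θ₁ * p) C fun x => rieszConv α g x * (|u x| ^ (p - 2) * u x) := by
  obtain ⟨C, hC⟩ := h.exists_bound
  have hU := memLp_abs_rpow_sub_two_mul h.one_lt_left hp hu
  have := holderTriple_rpow h.one_lt_left hp
  set U : RN N → ℝ := fun x => |u x| ^ (p - 2) * u x with hUd
  refine ⟨‖rieszConst N α‖₊ * (C * (eLpNorm U (ENNReal.ofReal (θ₁ * p / (p - 1)))).toNNReal *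
    (eLpNorm g (ENNReal.ofReal θ₂)).toNNReal), (aestronglyMeasurable_rieszConv α hg.1).mul hU.1,
    fun w hw => ?_⟩
  simp only [ENNReal.coe_mul]
  rw [ENNReal.coe_toNNReal hU.2.ne, ENNReal.coe_toNNReal hg.2.ne]
  -- The factor `U x * w x` is treated as a single function in L^{θ₁}: the Hardy-Littlewood-Sobolev
  -- inequality pairs it with g, and Hölder's inequality then separates U from w.
  calc ∫⁻ x, ‖rieszConv α g x * U x‖ₑ * ‖w x‖ₑ
      ≤ ∫⁻ x, ‖rieszConst N α‖ₑ * ∫⁻ y, ‖U x * w x‖ₑ * (‖normKernel N α (x - y)‖ₑ * ‖g y‖ₑ) := by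
        refine lintegral_mono fun x => ?_
        rw [rieszConv_apply, enorm_mul, enorm_mul, mul_assoc, mul_assoc, ← enorm_mul (U x),
          lintegral_const_mul' _ _ enorm_ne_top, mul_comm ‖U x * w x‖ₑ]
        gcongr
        refine (enorm_integral_le_lintegral_enorm _).trans (le_of_eq ?_)
        simp_rw [enorm_mul]
    _ = ‖rieszConst N α‖ₑ * ∫⁻ x, ∫⁻ y, ‖U x * w x‖ₑ *
          (‖normKernel N α (x - y)‖ₑ * ‖g y‖ₑ) := lintegral_const_mul' _ _ enorm_ne_top
    _ ≤ ‖rieszConst N α‖ₑ * (C * (eLpNorm (U • w) (ENNReal.ofReal θ₁) *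
          eLpNorm g (ENNReal.ofReal θ₂))) := by
        gcongr
        exact hC _ g (hU.1.mul hw) hg.1
    _ ≤ ‖rieszConst N α‖ₑ * (C * ((eLpNorm U (ENNReal.ofReal (θ₁ * p / (p - 1))) *
          eLpNorm w (ENNReal.ofReal (θ₁ * p))) * eLpNorm g (ENNReal.ofReal θ₂))) := by
        gcongr
        exact eLpNorm_smul_le_mul_eLpNorm hw hU.1
    _ = _ := by rw [enorm_eq_nnnorm]; ring

/-! ### Testing the equation -/

lemma partialDeriv_comm (i j : Fin N) {φ : RN N → ℝ} (h : ContDiff ℝ ∞ φ) (x : RN N) :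
    partialDeriv i (partialDeriv j φ) x = partialDeriv j (partialDeriv i φ) x := by
  have hs : IsSymmSndFDerivAt ℝ φ x := h.contDiffAt.isSymmSndFDerivAt (by
    rw [minSmoothness_of_isRCLikeNormedField]
    exact WithTop.coe_le_coe.2 (le_top (a := (2 : ℕ∞))))
  have hd : DifferentiableAt ℝ (fderiv ℝ φ) x :=
    (h.fderiv_right (m := ∞) (by simp)).differentiable (by simp) x
  have key : ∀ a b : Fin N, partialDeriv a (partialDeriv b φ) x =
      fderiv ℝ (fderiv ℝ φ) x (EuclideanSpace.single a 1) (EuclideanSpace.single b 1) := by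
    intro a b
    have h1 : HasFDerivAt (partialDeriv b φ) _ x :=
      hd.hasFDerivAt.clm_apply (hasFDerivAt_const (EuclideanSpace.single b (1 : ℝ)) x)
    rw [partialDeriv, h1.fderiv]
    simp
  rw [key, key]
  exact hs _ _

/-- Second weak derivatives commute. -/
lemma weakHessian_symm {u : RN N → ℝ} {G : Fin N → RN N → ℝ} (hG : IsWeakGradient u G)
    {i j : Fin N} {a b : RN N → ℝ} (ha : IsWeakPartial j (G i) a) (hb : IsWeakPartial i (G j) b) :
    a =ᵐ[volume] b := by
  refine ae_eq_of_integral_contDiff_smul_eq ha.2.1 hb.2.1 fun φ h1 h2 => ?_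
  have hφ : IsTestFunction φ := ⟨h1, h2⟩
  have e1 := ha.2.2 φ hφ
  have e2 := hb.2.2 φ hφ
  have e3 := (hG i).2.2 _ (hφ.partialDeriv j)
  have e4 := (hG j).2.2 _ (hφ.partialDeriv i)
  simp_rw [partialDeriv_comm i j h1] at e3
  simp only [smul_eq_mul, mul_comm (φ _)]
  linarith

/-- This is f ∂_i f = ∂_i(f²)/2, the chain rule for powers at exponent 2. -/
lemma integral_mul_mul_weakPartial {i : Fin N} {f g ψ : RN N → ℝ} (h : IsWeakPartial i f g)
    (hf : MemLpLoc 2 f) (hg : MemLpLoc 2 g) (hψ : IsTestFunction ψ) :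
    ∫ x, f x * (ψ x * g x) = -(1 / 2) * ∫ x, f x ^ 2 * partialDeriv i ψ x := by
  have h2 : ENNReal.ofReal 2 = 2 := by simp
  have := (h.abs_rpow one_lt_two (by rwa [h2]) (by rwa [h2])).2.2 ψ hψ
  simp only [Real.rpow_two, sq_abs] at this
  rw [this, neg_mul_neg, ← integral_const_mul]
  refine integral_congr_ae (Eventually.of_forall fun x => ?_)
  simp only [powDeriv, sub_self, Real.rpow_zero]
  ring

/-- The equation `-Δu + u = c R` may be tested with `ζ w` for `w` in a local Sobolev space. -/
theorem integral_test_mul {u R w : RN N → ℝ} {G W : Fin N → RN N → ℝ} {c r : ℝ} {C : ℝ≥0}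
    (hr : 1 ≤ r) (hu : MemLp u 2) (hG2 : ∀ i, MemLp (G i) 2) (hR : PairingBound r C R)
    (heq : ∀ φ : RN N → ℝ, IsTestFunction φ →
      ∫ x, ((∑ i, G i x * partialDeriv i φ x) + u x * φ x) = c * ∫ x, R x * φ x)
    (hW : IsWeakGradient w W) (hwr : MemLpLoc (ENNReal.ofReal r) w) (hw2 : MemLpLoc 2 w)
    (hW2 : ∀ i, MemLpLoc 2 (W i)) {ζ : RN N → ℝ} (hζ : IsTestFunction ζ) :
    (∑ i, ((∫ x, G i x * (partialDeriv i ζ x * w x)) + ∫ x, G i x * (ζ x * W i x))) +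
      ∫ x, u x * (ζ x * w x) = c * ∫ x, R x * (ζ x * w x) := by
  have h2 : ENNReal.ofReal 2 = 2 := by simp
  rw [← h2] at hw2
  simp_rw [← h2] at hW2
  have hlw : LocallyIntegrable w := hw2.locallyIntegrable (by simp)
  have hlW : ∀ i, LocallyIntegrable (W i) := fun i => (hW2 i).locallyIntegrable (by simp)
  choose A hA using fun i => exists_pairingBound_two (hG2 i)
  obtain ⟨B, hB⟩ := exists_pairingBound_two hu
  have hsm : ∀ n, ContDiff ℝ ∞ (mollify n w) := fun n => contDiff_mollify n hlw
  have hsmW : ∀ n i, ContDiff ℝ ∞ (mollify n (W i)) := fun n i => contDiff_mollify n (hlW i)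
  -- With w mollified, the product with ζ is smooth of compact support and the equation applies
  -- directly. In the limit the left-hand side uses L²_loc convergence and the right-hand side
  -- L^r_loc convergence.
  have hn : ∀ n, (∑ i, ((∫ x, G i x * (partialDeriv i ζ x * mollify n w x)) +
      ∫ x, G i x * (ζ x * mollify n (W i) x))) + ∫ x, u x * (ζ x * mollify n w x) =
      c * ∫ x, R x * (ζ x * mollify n w x) := by
    intro n
    have I1 : ∀ i, Integrable fun x => G i x * (partialDeriv i ζ x * mollify n w x) :=
      fun i => (hA i).integrable (hζ.partialDeriv i).continuous (hζ.partialDeriv i).2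
        (memLpLoc_of_continuous (hsm n).continuous _)
    have I2 : ∀ i, Integrable fun x => G i x * (ζ x * mollify n (W i) x) :=
      fun i => (hA i).integrable hζ.continuous hζ.2
        (memLpLoc_of_continuous (hsmW n i).continuous _)
    have I3 : Integrable fun x => u x * (ζ x * mollify n w x) :=
      hB.integrable hζ.continuous hζ.2 (memLpLoc_of_continuous (hsm n).continuous _)
    rw [← heq _ (hζ.mul_right (hsm n))]
    have e2 : ∀ i, (∫ x, G i x * (partialDeriv i ζ x * mollify n w x)) +
        (∫ x, G i x * (ζ x * mollify n (W i) x)) = ∫ x, (G i x * (partialDeriv i ζ x *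
        mollify n w x) + G i x * (ζ x * mollify n (W i) x)) := fun i =>
      (integral_add (I1 i) (I2 i)).symm
    have I5 : ∀ i, Integrable fun x => G i x * (partialDeriv i ζ x * mollify n w x) +
        G i x * (ζ x * mollify n (W i) x) := fun i => (I1 i).add (I2 i)
    simp_rw [e2]
    rw [← integral_finsetSum Finset.univ fun i _ => I5 i,
      ← integral_add (integrable_finsetSum _ fun i _ => I5 i) I3]
    refine integral_congr_ae (Eventually.of_forall fun x => ?_)
    simp only [partialDeriv_mul _ (hζ.differentiable x) ((hsm n).differentiable (by simp) x),
      partialDeriv_mollify _ n (hW _), mul_add]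
  have hL : Tendsto (fun n => (∑ i, ((∫ x, G i x * (partialDeriv i ζ x * mollify n w x)) +
      ∫ x, G i x * (ζ x * mollify n (W i) x))) + ∫ x, u x * (ζ x * mollify n w x)) atTop
      (𝓝 ((∑ i, ((∫ x, G i x * (partialDeriv i ζ x * w x)) + ∫ x, G i x * (ζ x * W i x))) +
      ∫ x, u x * (ζ x * w x))) := by
    refine Tendsto.add (tendsto_finsetSum _ fun i _ => Tendsto.add ?_ ?_) ?_
    · exact tendsto_integral_pairing_mollify one_le_two (hA i) (hζ.partialDeriv i).continuous
        (hζ.partialDeriv i).2 hw2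
    · exact tendsto_integral_pairing_mollify one_le_two (hA i) hζ.continuous hζ.2 (hW2 i)
    · exact tendsto_integral_pairing_mollify one_le_two hB hζ.continuous hζ.2 hw2
  have hRl := (tendsto_integral_pairing_mollify hr hR hζ.continuous hζ.2 hwr).const_mul c
  exact tendsto_nhds_unique (hL.congr hn) hRl

/-- The result of testing `-Δu + u = c R` with `ζ ∂_j u`. -/
theorem integral_pohozaev_local {u R : RN N → ℝ} {G : Fin N → RN N → ℝ}
    {H : Fin N → Fin N → RN N → ℝ} {c r : ℝ} {C : ℝ≥0} (hr : 1 ≤ r) (hu : MemLp u 2)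
    (hG : IsWeakGradient u G) (hG2 : ∀ i, MemLp (G i) 2)
    (hGr : ∀ i, MemLpLoc (ENNReal.ofReal r) (G i))
    (hH : ∀ i, IsWeakGradient (G i) (H i)) (hH2 : ∀ i j, MemLpLoc 2 (H i j))
    (hR : PairingBound r C R)
    (heq : ∀ φ : RN N → ℝ, IsTestFunction φ →
      ∫ x, ((∑ i, G i x * partialDeriv i φ x) + u x * φ x) = c * ∫ x, R x * φ x)
    (j : Fin N) {ζ : RN N → ℝ} (hζ : IsTestFunction ζ) :
    (∑ i, ((∫ x, G i x * (partialDeriv i ζ x * G j x)) -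
        1 / 2 * ∫ x, G i x ^ 2 * partialDeriv j ζ x)) -
        1 / 2 * ∫ x, u x ^ 2 * partialDeriv j ζ x =
      c * ∫ x, R x * (ζ x * G j x) := by
  have hGl : ∀ i, MemLpLoc 2 (G i) := fun i => MemLpLoc.of_memLp (hG2 i)
  rw [← integral_test_mul hr hu hG2 hR heq (hH j) (hGr j) (hGl j) (hH2 j) hζ,
    integral_mul_mul_weakPartial (hG j) (MemLpLoc.of_memLp hu) (hGl j) hζ, neg_mul,
    ← sub_eq_add_neg]
  congr 1
  refine Finset.sum_congr rfl fun i _ => ?_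
  rw [sub_eq_add_neg, ← neg_mul, ← integral_mul_mul_weakPartial (hH i j) (hGl i) (hH2 i j) hζ]
  congr 1
  refine integral_congr_ae ?_
  -- Testing with ζ ∂_j u produces ∂_i ∂_j u. Only after exchanging the derivatives is the term G_i
  -- ∂_j G_i = ∂_j(G_i²)/2.
  filter_upwards [weakHessian_symm hG (hH i j) (hH j i)] with x hx
  rw [hx]

/-! ### Bounds for test functions and dominated convergence in double integrals. -/

lemma IsTestFunction.exists_bound {φ : RN N → ℝ} (h : IsTestFunction φ) :
    ∃ B : ℝ, 0 ≤ B ∧ ∀ x, |φ x| ≤ B := by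
  obtain ⟨B, hB⟩ := h.continuous.bounded_above_of_compact_support h.2
  exact ⟨|B|, abs_nonneg B, fun x => (hB x).trans (le_abs_self B)⟩

lemma IsTestFunction.exists_lipschitz {φ : RN N → ℝ} (h : IsTestFunction φ) :
    ∃ L : ℝ, 0 ≤ L ∧ ∀ x y, |φ x - φ y| ≤ L * ‖x - y‖ := by
  obtain ⟨L, hL⟩ := ContDiff.lipschitzWith_of_hasCompactSupport h.2 h.1 (by simp)
  refine ⟨L, L.2, fun x y => ?_⟩
  rw [← Real.norm_eq_abs, ← dist_eq_norm, ← dist_eq_norm]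
  exact hL.dist_le_mul x y

/-- `normKernel` has the conventional value 0 at the origin when α < N, so estimates by it are only
available off the diagonal. In positive dimension the diagonal is null. -/
lemma ae_prod_fst_ne_snd (hN : 1 ≤ N) :
    ∀ᵐ z : RN N × RN N ∂volume.prod volume, z.1 - z.2 ≠ 0 := by
  have : Nonempty (Fin N) := ⟨⟨0, hN⟩⟩
  have hm : MeasurableSet {z : RN N × RN N | z.1 - z.2 ≠ 0} :=
    (measurableSet_singleton (0 : RN N)).compl.preimage (by fun_prop)
  rw [Measure.ae_prod_iff_ae_ae hm]
  refine Eventually.of_forall fun x => ?_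
  have : ∀ᵐ y : RN N, y ≠ x := Measure.ae_ne volume x
  filter_upwards [this] with y hy
  rw [sub_ne_zero]
  exact hy.symm

/-- Dominated convergence, with the Riesz double integral as the dominating function; the constant B
must be uniform in n. -/
lemma HLSAdmissible.tendsto_integral_of_le {α θ₁ θ₂ : ℝ} (h : HLSAdmissible N α θ₁ θ₂)
    {f g : RN N → ℝ} (hf : MemLp f (ENNReal.ofReal θ₁)) (hg : MemLp g (ENNReal.ofReal θ₂))
    {m : ℕ → RN N × RN N → ℝ} {m₀ : RN N × RN N → ℝ}
    (hm : ∀ n, AEStronglyMeasurable (m n) (volume.prod volume)) {B : ℝ}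
    (hB : ∀ n z, z.1 - z.2 ≠ 0 → |m n z| ≤ B * normKernel N α (z.1 - z.2))
    (hlim : ∀ z, z.1 - z.2 ≠ 0 → Tendsto (fun n => m n z) atTop (𝓝 (m₀ z))) :
    Tendsto (fun n => ∫ z : RN N × RN N, m n z * (f z.1 * g z.2) ∂volume.prod volume) atTop
      (𝓝 (∫ z : RN N × RN N, m₀ z * (f z.1 * g z.2) ∂volume.prod volume)) := by
  have hdiag := ae_prod_fst_ne_snd h.dim_pos
  refine tendsto_integral_of_dominated_convergence
    (fun z => B * ‖normKernel N α (z.1 - z.2) * (f z.1 * g z.2)‖) (fun n => ?_)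
    ((h.integrable hf hg).norm.const_mul B) (fun n => ?_) ?_
  · exact (hm n).mul (hf.1.comp_fst.mul hg.1.comp_snd)
  · filter_upwards [hdiag] with z hz
    rw [norm_mul, norm_mul (normKernel _ _ _), Real.norm_of_nonneg (normKernel_nonneg _ _),
      ← mul_assoc]
    exact mul_le_mul_of_nonneg_right (hB n z hz) (norm_nonneg _)
  · filter_upwards [hdiag] with z hz
    exact (hlim z hz).mul_const _

/-! ### The regularized kernel -/

/-- A smooth approximation of `normKernel`. -/
def regKernel (N : ℕ) (α ε : ℝ) (z : RN N) : ℝ := (‖z‖ ^ 2 + ε) ^ (-((N : ℝ) - α) / 2)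

variable {α ε : ℝ}

lemma regKernel_nonneg (hε : 0 < ε) (z : RN N) : 0 ≤ regKernel N α ε z := by
  unfold regKernel; positivity

lemma contDiff_regKernel (hε : 0 < ε) : ContDiff ℝ ∞ (regKernel N α ε) := by
  refine ContDiff.rpow_const_of_ne ((contDiff_norm_sq ℝ).add contDiff_const) fun z => ?_
  positivity

lemma partialDeriv_regKernel (hε : 0 < ε) (j : Fin N) (z : RN N) :
    partialDeriv j (regKernel N α ε) z =
      -((N : ℝ) - α) * (z j / (‖z‖ ^ 2 + ε)) * regKernel N α ε z := by
  have hpos : 0 < ‖z‖ ^ 2 + ε := by positivity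
  have h1 : HasFDerivAt (fun z : RN N => ‖z‖ ^ 2 + ε) (2 • innerSL ℝ z) z :=
    (hasStrictFDerivAt_norm_sq z).hasFDerivAt.add_const ε
  have h2 : HasFDerivAt (regKernel N α ε) _ z :=
    h1.rpow_const (p := -((N : ℝ) - α) / 2) (Or.inl hpos.ne')
  rw [partialDeriv, h2.fderiv, regKernel, Real.rpow_sub_one hpos.ne']
  simp [EuclideanSpace.inner_single_right]
  field_simp

lemma regKernel_le (hαN : α < N) (hε : 0 < ε) {z : RN N} (hz : z ≠ 0) :
    regKernel N α ε z ≤ normKernel N α z := by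
  have hpos : 0 < ‖z‖ := norm_pos_iff.2 hz
  calc regKernel N α ε z ≤ (‖z‖ ^ 2) ^ (-((N : ℝ) - α) / 2) :=
        Real.rpow_le_rpow_of_nonpos (by positivity) (by linarith) (by linarith)
    _ = normKernel N α z := by
        rw [normKernel, ← Real.rpow_natCast, ← Real.rpow_mul hpos.le]
        congr 1
        push_cast
        ring

lemma tendsto_regKernel {ε : ℕ → ℝ} (hε : Tendsto ε atTop (𝓝 0)) {z : RN N} (hz : z ≠ 0) :
    Tendsto (fun n => regKernel N α (ε n) z) atTop (𝓝 (normKernel N α z)) := by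
  have hpos : 0 < ‖z‖ := norm_pos_iff.2 hz
  have h1 : Tendsto (fun n => ‖z‖ ^ 2 + ε n) atTop (𝓝 (‖z‖ ^ 2)) := by
    simpa using hε.const_add (‖z‖ ^ 2)
  have h2 := h1.rpow_const (p := -((N : ℝ) - α) / 2) (Or.inl (by positivity))
  have h3 : normKernel N α z = (‖z‖ ^ 2) ^ (-((N : ℝ) - α) / 2) := by
    rw [normKernel, ← Real.rpow_natCast, ← Real.rpow_mul hpos.le]
    congr 1
    push_cast
    ring
  rw [h3]
  exact h2

lemma abs_apply_le_norm (z : RN N) (j : Fin N) : |z j| ≤ ‖z‖ := by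
  simpa using PiLp.norm_apply_le z j

lemma partialDeriv_comp_sub_right (i : Fin N) (φ : RN N → ℝ) (x y : RN N) :
    partialDeriv i (fun x => φ (x - y)) x = partialDeriv i φ (x - y) := by
  rw [partialDeriv, partialDeriv, fderiv_comp_sub]

lemma continuous_partialDeriv_regKernel (hε : 0 < ε) (j : Fin N) :
    Continuous (partialDeriv j (regKernel N α ε)) :=
  (contDiff_partialDeriv j (contDiff_regKernel hε)).continuous

/-- Differentiating the kernel costs one power of ‖z‖, and the Lipschitz factor returns it. The
resulting bound is uniform in ε up to the kernel itself, which permits ε → 0. -/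
lemma abs_partialDeriv_regKernel_mul_le (hαN : α < N) (hε : 0 < ε) (j : Fin N) {z : RN N}
    {L a : ℝ} (hL : 0 ≤ L) (ha : |a| ≤ L * ‖z‖) :
    |partialDeriv j (regKernel N α ε) z * a| ≤ (N - α) * L * regKernel N α ε z := by
  have hpos : 0 < ‖z‖ ^ 2 + ε := by positivity
  have hr := regKernel_nonneg (α := α) hε z
  rw [partialDeriv_regKernel hε, abs_mul, abs_mul, abs_mul, abs_neg, abs_of_pos (sub_pos.2 hαN),
    abs_of_nonneg hr, abs_div, abs_of_pos hpos]
  have h1 : |z j| / (‖z‖ ^ 2 + ε) * |a| ≤ L := by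
    rw [div_mul_eq_mul_div, div_le_iff₀ hpos]
    calc |z j| * |a| ≤ ‖z‖ * (L * ‖z‖) :=
          mul_le_mul (abs_apply_le_norm z j) ha (abs_nonneg _) (norm_nonneg _)
      _ = L * ‖z‖ ^ 2 := by ring
      _ ≤ L * (‖z‖ ^ 2 + ε) := by gcongr; linarith
  calc _ = (N - α) * (|z j| / (‖z‖ ^ 2 + ε) * |a|) * regKernel N α ε z := by ring
    _ ≤ _ := by
      have : 0 < (N : ℝ) - α := sub_pos.2 hαN
      gcongr

/-- The constant blows up as ε → 0. This bound only serves integrability at fixed ε, before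
symmetrization produces a difference X(x) - X(y). -/
lemma abs_partialDeriv_regKernel_le (hαN : α < N) (hε : 0 < ε) (j : Fin N) (z : RN N) :
    |partialDeriv j (regKernel N α ε) z| ≤ (N - α) * (1 + 1 / ε) * regKernel N α ε z := by
  have hpos : 0 < ‖z‖ ^ 2 + ε := by positivity
  have hr := regKernel_nonneg (α := α) hε z
  rw [partialDeriv_regKernel hε, abs_mul, abs_mul, abs_neg, abs_of_pos (sub_pos.2 hαN),
    abs_of_nonneg hr, abs_div, abs_of_pos hpos]
  have h1 : |z j| / (‖z‖ ^ 2 + ε) ≤ 1 + 1 / ε := by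
    rw [div_le_iff₀ hpos]
    have h2 : (1 + 1 / ε) * (‖z‖ ^ 2 + ε) = ‖z‖ ^ 2 + ε + ‖z‖ ^ 2 / ε + 1 := by
      field_simp
      ring
    have h3 : 0 ≤ ‖z‖ ^ 2 / ε := by positivity
    rw [h2]
    nlinarith [abs_apply_le_norm z j, sq_nonneg (‖z‖ - 1)]
  have : 0 < (N : ℝ) - α := sub_pos.2 hαN
  gcongr

lemma HLSAdmissible.integrable_partialDeriv_regKernel {θ₁ θ₂ : ℝ} (h : HLSAdmissible N α θ₁ θ₂)
    (hε : 0 < ε) {j : Fin N} {F g X : RN N → ℝ} (hF : MemLp F (ENNReal.ofReal θ₁))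
    (hg : MemLp g (ENNReal.ofReal θ₂)) (hX : IsTestFunction X) :
    Integrable (fun z : RN N × RN N => (partialDeriv j (regKernel N α ε) (z.1 - z.2) *
      X z.1 + regKernel N α ε (z.1 - z.2) * partialDeriv j X z.1) * (F z.1 * g z.2))
      (volume.prod volume) := by
  obtain ⟨B, hB0, hB⟩ := hX.exists_bound
  obtain ⟨B', hB'0, hB'⟩ := (hX.partialDeriv j).exists_bound
  have hdiag := ae_prod_fst_ne_snd h.dim_pos
  have hkc := (contDiff_regKernel (N := N) (α := α) hε).continuous
  have hdc := continuous_partialDeriv_regKernel (N := N) (α := α) hε j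
  have hXc := hX.continuous
  have hX'c := (hX.partialDeriv j).continuous
  have hαN := h.lt_dim
  have hpos : 0 < (N : ℝ) - α := sub_pos.2 hαN
  refine h.integrable_of_le hF hg (Continuous.aestronglyMeasurable (by fun_prop))
    (B := (N - α) * (1 + 1 / ε) * B + B') ?_
  filter_upwards [hdiag] with z hz
  have hk := regKernel_le hαN hε hz
  have hk0 := regKernel_nonneg (α := α) hε (z.1 - z.2)
  calc _ ≤ |partialDeriv j (regKernel N α ε) (z.1 - z.2)| * |X z.1| +
        regKernel N α ε (z.1 - z.2) * |partialDeriv j X z.1| := by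
        refine (abs_add_le _ _).trans (le_of_eq ?_)
        rw [abs_mul, abs_mul, abs_of_nonneg hk0]
    _ ≤ ((N - α) * (1 + 1 / ε) * regKernel N α ε (z.1 - z.2)) * B +
        regKernel N α ε (z.1 - z.2) * B' := by
        gcongr
        · exact abs_partialDeriv_regKernel_le hαN hε j _
        · exact hB _
        · exact hB' _
    _ = ((N - α) * (1 + 1 / ε) * B + B') * regKernel N α ε (z.1 - z.2) := by ring
    _ ≤ _ := by gcongr

/-- Integration by parts in the first variable, against the regularized kernel. -/
lemma HLSAdmissible.integral_regKernel_weakPartial {θ₁ θ₂ : ℝ} (h : HLSAdmissible N α θ₁ θ₂)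
    (hε : 0 < ε) {j : Fin N} {F DF g X : RN N → ℝ} (hF : MemLp F (ENNReal.ofReal θ₁))
    (hDF : MemLp DF (ENNReal.ofReal θ₁)) (hw : IsWeakPartial j F DF)
    (hg : MemLp g (ENNReal.ofReal θ₂)) (hX : IsTestFunction X) :
    ∫ z : RN N × RN N, (regKernel N α ε (z.1 - z.2) * X z.1) * (DF z.1 * g z.2)
        ∂volume.prod volume =
      -∫ z : RN N × RN N, (partialDeriv j (regKernel N α ε) (z.1 - z.2) * X z.1 +
        regKernel N α ε (z.1 - z.2) * partialDeriv j X z.1) * (F z.1 * g z.2)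
        ∂volume.prod volume := by
  obtain ⟨B, hB0, hB⟩ := hX.exists_bound
  obtain ⟨B', hB'0, hB'⟩ := (hX.partialDeriv j).exists_bound
  have hdiag := ae_prod_fst_ne_snd h.dim_pos
  have hkc := (contDiff_regKernel (N := N) (α := α) hε).continuous
  have hdc := continuous_partialDeriv_regKernel (N := N) (α := α) hε j
  have hXc := hX.continuous
  have hX'c := (hX.partialDeriv j).continuous
  have hαN := h.lt_dim
  have hpos : 0 < (N : ℝ) - α := sub_pos.2 hαN
  have I1 : Integrable (fun z : RN N × RN N => (regKernel N α ε (z.1 - z.2) * X z.1) *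
      (DF z.1 * g z.2)) (volume.prod volume) := by
    refine h.integrable_of_le hDF hg (Continuous.aestronglyMeasurable (by fun_prop)) (B := B) ?_
    filter_upwards [hdiag] with z hz
    rw [abs_mul, abs_of_nonneg (regKernel_nonneg hε _), mul_comm]
    exact mul_le_mul (hB _) (regKernel_le hαN hε hz) (regKernel_nonneg hε _) hB0
  have I2 := h.integrable_partialDeriv_regKernel hε hF hg hX (j := j)
  rw [integral_prod_symm _ I1, integral_prod_symm _ I2, ← integral_neg]
  refine integral_congr_ae (Eventually.of_forall fun y => ?_)
  have hsm : ContDiff ℝ ∞ fun x : RN N => regKernel N α ε (x - y) :=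
    (contDiff_regKernel hε).comp (contDiff_id.sub contDiff_const)
  -- This is where regularization is needed: for fixed y the smooth kernel times X is an admissible
  -- test function in x.
  have htest : IsTestFunction fun x : RN N => regKernel N α ε (x - y) * X x := hX.mul_left hsm
  have key := hw.2.2 _ htest
  simp_rw [partialDeriv_mul j (hsm.differentiable (by simp) _) (hX.differentiable _),
    partialDeriv_comp_sub_right] at key
  calc ∫ x, (regKernel N α ε (x - y) * X x) * (DF x * g y)
      = (∫ x, DF x * (regKernel N α ε (x - y) * X x)) * g y := by
        rw [← integral_mul_const]
        refine integral_congr_ae (Eventually.of_forall fun x => ?_)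
        simp only
        ring
    _ = -((∫ x, F x * (partialDeriv j (regKernel N α ε) (x - y) * X x +
          regKernel N α ε (x - y) * partialDeriv j X x)) * g y) := by rw [key]; ring
    _ = _ := by
        rw [← integral_mul_const]
        congr 1
        refine integral_congr_ae (Eventually.of_forall fun x => ?_)
        simp only
        ring

lemma regKernel_neg (z : RN N) : regKernel N α ε (-z) = regKernel N α ε z := by
  simp only [regKernel, norm_neg]

lemma partialDeriv_regKernel_neg (hε : 0 < ε) (j : Fin N) (z : RN N) :
    partialDeriv j (regKernel N α ε) (-z) = -partialDeriv j (regKernel N α ε) z := by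
  rw [partialDeriv_regKernel hε, partialDeriv_regKernel hε, regKernel_neg, norm_neg, PiLp.neg_apply]
  ring

/-- Integration by parts in x is added to integration by parts in y. The gradient of the kernel is
odd, so its two occurrences combine into one multiplied by X(x) - X(y). -/
lemma HLSAdmissible.integral_regKernel_symm {θ₁ θ₂ : ℝ} (h : HLSAdmissible N α θ₁ θ₂)
    (hε : 0 < ε) {j : Fin N} {F DF g Dg X : RN N → ℝ} (hF : MemLp F (ENNReal.ofReal θ₁))
    (hDF : MemLp DF (ENNReal.ofReal θ₁)) (hwF : IsWeakPartial j F DF)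
    (hg : MemLp g (ENNReal.ofReal θ₂)) (hDg : MemLp Dg (ENNReal.ofReal θ₂))
    (hwg : IsWeakPartial j g Dg) (hX : IsTestFunction X) :
    (∫ z : RN N × RN N, (regKernel N α ε (z.1 - z.2) * X z.1) * (DF z.1 * g z.2)
        ∂volume.prod volume) +
      (∫ z : RN N × RN N, (regKernel N α ε (z.1 - z.2) * X z.2) * (F z.1 * Dg z.2)
        ∂volume.prod volume) =
      -∫ z : RN N × RN N, (partialDeriv j (regKernel N α ε) (z.1 - z.2) * (X z.1 - X z.2) +
        regKernel N α ε (z.1 - z.2) * (partialDeriv j X z.1 + partialDeriv j X z.2)) *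
          (F z.1 * g z.2) ∂volume.prod volume := by
  have I1 := h.integrable_partialDeriv_regKernel hε hF hg hX (j := j)
  have I2 := (h.symm.integrable_partialDeriv_regKernel hε hg hF hX (j := j)).swap
  have E2 := h.symm.integral_regKernel_weakPartial hε hg hDg hwg hF hX
  rw [← integral_prod_swap, ← integral_prod_swap (fun z : RN N × RN N =>
    (partialDeriv j (regKernel N α ε) (z.1 - z.2) * X z.1 +
        regKernel N α ε (z.1 - z.2) * partialDeriv j X z.1) * (g z.1 * F z.2))] at E2
  have E3 : ∫ z : RN N × RN N, (regKernel N α ε (z.1 - z.2) * X z.2) * (F z.1 * Dg z.2)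
      ∂volume.prod volume = ∫ z : RN N × RN N, (regKernel N α ε (z.swap.1 - z.swap.2) *
        X z.swap.1) * (Dg z.swap.1 * F z.swap.2) ∂volume.prod volume := by
    refine integral_congr_ae (Eventually.of_forall fun z => ?_)
    simp only [Prod.fst_swap, Prod.snd_swap]
    rw [← neg_sub z.1 z.2, regKernel_neg]
    ring
  rw [h.integral_regKernel_weakPartial hε hF hDF hwF hg hX, E3, E2, ← neg_add]
  refine congrArg Neg.neg ((integral_add I1 I2).symm.trans ?_)
  refine integral_congr_ae (Eventually.of_forall fun z => ?_)
  simp only [Prod.fst_swap, Prod.snd_swap, Function.comp]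
  rw [← neg_sub z.1 z.2, regKernel_neg, partialDeriv_regKernel_neg hε]
  ring

/-- The nonlocal integration by parts formula behind the Pohozaev identity. -/
theorem HLSAdmissible.integral_normKernel_symm {θ₁ θ₂ : ℝ} (h : HLSAdmissible N α θ₁ θ₂)
    {j : Fin N} {F DF g Dg X : RN N → ℝ} (hF : MemLp F (ENNReal.ofReal θ₁))
    (hDF : MemLp DF (ENNReal.ofReal θ₁)) (hwF : IsWeakPartial j F DF)
    (hg : MemLp g (ENNReal.ofReal θ₂)) (hDg : MemLp Dg (ENNReal.ofReal θ₂))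
    (hwg : IsWeakPartial j g Dg) (hX : IsTestFunction X) :
    (∫ z : RN N × RN N, (normKernel N α (z.1 - z.2) * X z.1) * (DF z.1 * g z.2)
        ∂volume.prod volume) +
      (∫ z : RN N × RN N, (normKernel N α (z.1 - z.2) * X z.2) * (F z.1 * Dg z.2)
        ∂volume.prod volume) =
      -∫ z : RN N × RN N, (normKernel N α (z.1 - z.2) *
        (-((N : ℝ) - α) * ((z.1 - z.2) j * (X z.1 - X z.2) / ‖z.1 - z.2‖ ^ 2) +
        (partialDeriv j X z.1 + partialDeriv j X z.2))) * (F z.1 * g z.2) ∂volume.prod volume := by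
  obtain ⟨B, hB0, hB⟩ := hX.exists_bound
  obtain ⟨B', hB'0, hB'⟩ := (hX.partialDeriv j).exists_bound
  obtain ⟨L, hL0, hL⟩ := hX.exists_lipschitz
  have hαN := h.lt_dim
  have hpos : 0 < (N : ℝ) - α := sub_pos.2 hαN
  set ε : ℕ → ℝ := fun n => 1 / ((n : ℝ) + 1) with hεd
  have hε : ∀ n, 0 < ε n := fun n => by positivity
  have hε0 : Tendsto ε atTop (𝓝 0) := tendsto_one_div_add_atTop_nhds_zero_nat
  have hkc := fun n => (contDiff_regKernel (N := N) (α := α) (hε n)).continuous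
  have hdc := fun n => continuous_partialDeriv_regKernel (N := N) (α := α) (hε n) j
  have hXc := hX.continuous
  have hX'c := (hX.partialDeriv j).continuous
  have hbd : ∀ (a : ℝ), |a| ≤ B → ∀ n, ∀ z : RN N × RN N, z.1 - z.2 ≠ 0 →
      |regKernel N α (ε n) (z.1 - z.2) * a| ≤ B * normKernel N α (z.1 - z.2) := by
    intro a ha n z hz
    rw [abs_mul, abs_of_nonneg (regKernel_nonneg (hε n) _), mul_comm]
    exact mul_le_mul ha (regKernel_le hαN (hε n) hz) (regKernel_nonneg (hε n) _) hB0
  have L1 := h.tendsto_integral_of_le hDF hg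
    (m := fun n z => regKernel N α (ε n) (z.1 - z.2) * X z.1)
    (fun n => Continuous.aestronglyMeasurable (by have := hkc n; fun_prop))
    (fun n z hz => hbd _ (hB _) n z hz)
    (fun z hz => (tendsto_regKernel hε0 hz).mul_const _)
  have L2 := h.tendsto_integral_of_le hF hDg
    (m := fun n z => regKernel N α (ε n) (z.1 - z.2) * X z.2)
    (fun n => Continuous.aestronglyMeasurable (by have := hkc n; fun_prop))
    (fun n z hz => hbd _ (hB _) n z hz)
    (fun z hz => (tendsto_regKernel hε0 hz).mul_const _)
  have L3 := h.tendsto_integral_of_le hF hg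
    (m := fun n z => partialDeriv j (regKernel N α (ε n)) (z.1 - z.2) * (X z.1 - X z.2) +
        regKernel N α (ε n) (z.1 - z.2) * (partialDeriv j X z.1 + partialDeriv j X z.2))
    (m₀ := fun z => normKernel N α (z.1 - z.2) *
        (-((N : ℝ) - α) * ((z.1 - z.2) j * (X z.1 - X z.2) / ‖z.1 - z.2‖ ^ 2) +
        (partialDeriv j X z.1 + partialDeriv j X z.2)))
    (B := (N - α) * L + 2 * B')
    (fun n => Continuous.aestronglyMeasurable (by have := hkc n; have := hdc n; fun_prop))
    (fun n z hz => by
      have hk := regKernel_le hαN (hε n) hz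
      have hk0 := regKernel_nonneg (α := α) (hε n) (z.1 - z.2)
      calc _ ≤ |partialDeriv j (regKernel N α (ε n)) (z.1 - z.2) * (X z.1 - X z.2)| +
            regKernel N α (ε n) (z.1 - z.2) * |partialDeriv j X z.1 + partialDeriv j X z.2| := by
            refine (abs_add_le _ _).trans (le_of_eq ?_)
            rw [abs_mul (regKernel _ _ _ _), abs_of_nonneg hk0]
        _ ≤ (N - α) * L * regKernel N α (ε n) (z.1 - z.2) +
            regKernel N α (ε n) (z.1 - z.2) * (B' + B') := by
            gcongr
            · exact abs_partialDeriv_regKernel_mul_le hαN (hε n) j hL0 (hL _ _)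
            · exact (abs_add_le _ _).trans (add_le_add (hB' _) (hB' _))
        _ = ((N - α) * L + 2 * B') * regKernel N α (ε n) (z.1 - z.2) := by ring
        _ ≤ _ := by gcongr)
    (fun z hz => by
      have hz0 : ‖z.1 - z.2‖ ^ 2 ≠ 0 := by simpa using hz
      have h1 := tendsto_regKernel (α := α) hε0 hz
      have h2 : Tendsto (fun n => ‖z.1 - z.2‖ ^ 2 + ε n) atTop (𝓝 (‖z.1 - z.2‖ ^ 2)) := by
        simpa using hε0.const_add (‖z.1 - z.2‖ ^ 2)
      have h3 := ((((h2.inv₀ hz0).const_mul ((z.1 - z.2) j)).const_mul (-((N : ℝ) - α))).mul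
        h1).mul_const (X z.1 - X z.2)
      have h4 := h3.add (h1.mul_const (partialDeriv j X z.1 + partialDeriv j X z.2))
      simp only [partialDeriv_regKernel (hε _)]
      convert h4 using 2 <;> (simp only [div_eq_mul_inv] <;> ring))
  exact tendsto_nhds_unique ((L1.add L2).congr fun n =>
    h.integral_regKernel_symm (hε n) hF hDF hwF hg hDg hwg hX) L3.neg

/-! ### Cutoffs and the truncated dilation field -/

/-- A smooth cutoff, equal to one near the origin. -/
def cutoff (N : ℕ) : RN N → ℝ := (⟨1, 2, one_pos, one_lt_two⟩ : ContDiffBump (0 : RN N))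

lemma isTestFunction_cutoff : IsTestFunction (cutoff N) :=
  ⟨ContDiffBump.contDiff _, ContDiffBump.hasCompactSupport _⟩

lemma cutoff_zero : cutoff N 0 = 1 :=
  ContDiffBump.one_of_mem_closedBall _ (mem_closedBall_self zero_le_one)

/-- The scales `1 / (n + 1)`. -/
def scale (n : ℕ) : ℝ := 1 / ((n : ℝ) + 1)

lemma scale_pos (n : ℕ) : 0 < scale n := by unfold scale; positivity

lemma scale_le_one (n : ℕ) : scale n ≤ 1 := by
  rw [scale, div_le_one (by positivity)]
  linarith [(Nat.cast_nonneg n : (0 : ℝ) ≤ n)]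

lemma tendsto_scale : Tendsto scale atTop (𝓝 0) := tendsto_one_div_add_atTop_nhds_zero_nat

lemma tendsto_comp_scale {φ : RN N → ℝ} (h : Continuous φ) (x : RN N) :
    Tendsto (fun n => φ (scale n • x)) atTop (𝓝 (φ 0)) := by
  have := (h.tendsto _).comp (tendsto_scale.smul_const x)
  rwa [zero_smul] at this

lemma IsTestFunction.comp_smul {φ : RN N → ℝ} (h : IsTestFunction φ) {a : ℝ} (ha : a ≠ 0) :
    IsTestFunction fun x => φ (a • x) :=
  ⟨h.1.comp (contDiff_const_smul a), h.2.comp_homeomorph (Homeomorph.smulOfNeZero a ha)⟩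

lemma partialDeriv_comp_smul (i : Fin N) {φ : RN N → ℝ} (h : Differentiable ℝ φ) (a : ℝ) (x : RN N) :
    partialDeriv i (fun x => φ (a • x)) x = a * partialDeriv i φ (a • x) := by
  have h1 : HasFDerivAt (fun x : RN N => a • x) (a • ContinuousLinearMap.id ℝ (RN N)) x :=
    (hasFDerivAt_id x).const_smul a
  have h2 : HasFDerivAt (fun x => φ (a • x)) _ x := (h (a • x)).hasFDerivAt.comp x h1
  rw [partialDeriv, h2.fderiv]
  simp [partialDeriv]

/-- Components of the vector field `cutoff x • x`. -/
def baseField (j : Fin N) (x : RN N) : ℝ := cutoff N x * x j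

lemma contDiff_coord (j : Fin N) : ContDiff ℝ ∞ fun x : RN N => x j :=
  (EuclideanSpace.proj j : RN N →L[ℝ] ℝ).contDiff

lemma partialDeriv_coord (i j : Fin N) (x : RN N) :
    partialDeriv i (fun x : RN N => x j) x = if i = j then 1 else 0 := by
  have h : HasFDerivAt (fun x : RN N => x j) (EuclideanSpace.proj j : RN N →L[ℝ] ℝ) x :=
    (EuclideanSpace.proj j : RN N →L[ℝ] ℝ).hasFDerivAt
  rw [partialDeriv, h.fderiv]
  simp [eq_comm]

lemma isTestFunction_baseField (j : Fin N) : IsTestFunction (baseField j) :=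
  isTestFunction_cutoff.mul_right (contDiff_coord j)

lemma partialDeriv_baseField_zero (i j : Fin N) :
    partialDeriv i (baseField j) 0 = if i = j then 1 else 0 := by
  have := partialDeriv_mul i (isTestFunction_cutoff.differentiable (0 : RN N))
    ((contDiff_coord j).differentiable (by simp) 0)
  rw [partialDeriv_coord, cutoff_zero] at this
  refine Eq.trans this ?_
  simp

/-- The dilation field `x`, truncated at scale `n + 1`. -/
def dilationField (n : ℕ) (j : Fin N) (x : RN N) : ℝ := (scale n)⁻¹ * baseField j (scale n • x)

lemma isTestFunction_dilationField (n : ℕ) (j : Fin N) : IsTestFunction (dilationField n j) :=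
  ((isTestFunction_baseField j).comp_smul (scale_pos n).ne').mul_left contDiff_const

lemma partialDeriv_dilationField (n : ℕ) (i j : Fin N) (x : RN N) :
    partialDeriv i (dilationField n j) x = partialDeriv i (baseField j) (scale n • x) := by
  have hd := (isTestFunction_baseField j).differentiable
  have := partialDeriv_mul i (x := x) (f := fun _ : RN N => (scale n)⁻¹) (by fun_prop)
    (((isTestFunction_baseField j).comp_smul (scale_pos n).ne').differentiable x)
  rw [partialDeriv_comp_smul i hd, inv_mul_cancel_left₀ (scale_pos n).ne'] at this
  change partialDeriv i (fun x => (scale n)⁻¹ * baseField j (scale n • x)) x = _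
  rw [this]
  simp [partialDeriv]

lemma dilationField_eq (n : ℕ) (j : Fin N) (x : RN N) :
    dilationField n j x = cutoff N (scale n • x) * x j := by
  have := (scale_pos n).ne'
  rw [dilationField, baseField, PiLp.smul_apply, smul_eq_mul]
  field_simp

lemma tendsto_dilationField (j : Fin N) (x : RN N) :
    Tendsto (fun n => dilationField n j x) atTop (𝓝 (x j)) := by
  simp_rw [dilationField_eq]
  have := (tendsto_comp_scale (N := N) isTestFunction_cutoff.continuous x).mul_const (x j)
  rwa [cutoff_zero, one_mul] at this

lemma tendsto_partialDeriv_dilationField (i j : Fin N) (x : RN N) :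
    Tendsto (fun n => partialDeriv i (dilationField n j) x) atTop
      (𝓝 (if i = j then 1 else 0)) := by
  simp_rw [partialDeriv_dilationField]
  rw [← partialDeriv_baseField_zero i j]
  exact tendsto_comp_scale ((isTestFunction_baseField j).partialDeriv i).continuous x

/-- The rescaling a⁻¹ φ(a x) preserves Lipschitz constants. The fields have no sup bound uniform in
n, but the uniform control of differences and derivatives suffices for the limits. -/
lemma exists_dilationField_lipschitz (j : Fin N) :
    ∃ L : ℝ, 0 ≤ L ∧ ∀ n x y, |dilationField n j x - dilationField n j y| ≤ L * ‖x - y‖ := by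
  obtain ⟨L, hL0, hL⟩ := (isTestFunction_baseField j).exists_lipschitz
  refine ⟨L, hL0, fun n x y => ?_⟩
  have hs := scale_pos n
  rw [dilationField, dilationField, ← mul_sub, abs_mul, abs_of_pos (inv_pos.2 hs),
    inv_mul_le_iff₀ hs]
  refine (hL _ _).trans (le_of_eq ?_)
  rw [← smul_sub, norm_smul, Real.norm_of_nonneg hs.le]
  ring

lemma exists_partialDeriv_dilationField_bound (i j : Fin N) :
    ∃ B : ℝ, 0 ≤ B ∧ ∀ n x, |partialDeriv i (dilationField n j) x| ≤ B := by
  obtain ⟨B, hB0, hB⟩ := ((isTestFunction_baseField j).partialDeriv i).exists_bound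
  exact ⟨B, hB0, fun n x => by rw [partialDeriv_dilationField]; exact hB _⟩

lemma tendsto_integral_mul_of_bounded {a : RN N → ℝ} (ha : Integrable a) {b : ℕ → RN N → ℝ}
    (hb : ∀ n, Continuous (b n)) {B : ℝ} (hB : ∀ n x, |b n x| ≤ B) {c : ℝ}
    (hlim : ∀ x, Tendsto (fun n => b n x) atTop (𝓝 c)) :
    Tendsto (fun n => ∫ x, a x * b n x) atTop (𝓝 ((∫ x, a x) * c)) := by
  rw [← integral_mul_const]
  refine tendsto_integral_of_dominated_convergence (fun x => ‖a x‖ * B)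
    (fun n => ha.1.mul (hb n).aestronglyMeasurable) (ha.norm.mul_const B)
    (fun n => Eventually.of_forall fun x => ?_)
    (Eventually.of_forall fun x => (hlim x).const_mul _)
  rw [norm_mul]
  exact mul_le_mul_of_nonneg_left (hB n x) (norm_nonneg _)

lemma tendsto_integral_mul_partialDeriv_dilationField {a : RN N → ℝ} (ha : Integrable a)
    (i j : Fin N) :
    Tendsto (fun n => ∫ x, a x * partialDeriv i (dilationField n j) x) atTop
      (𝓝 ((∫ x, a x) * if i = j then 1 else 0)) := by
  obtain ⟨B, -, hB⟩ := exists_partialDeriv_dilationField_bound i j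
  exact tendsto_integral_mul_of_bounded ha
    (fun n => ((isTestFunction_dilationField n j).partialDeriv i).continuous) hB
    (tendsto_partialDeriv_dilationField i j)

/-! ### Solutions of a single equation -/

/-- A function `u` with gradient `G` and Hessian `H`, in the Sobolev spaces of the theorem, such
that `-Δu + u = c R` weakly. -/
structure RegularSolution (r c : ℝ) (R u : RN N → ℝ) (G : Fin N → RN N → ℝ)
    (H : Fin N → Fin N → RN N → ℝ) : Prop where
  one_le : 1 ≤ r
  memLp_two : MemLp u 2
  memLp : MemLp u (ENNReal.ofReal r)
  grad : IsWeakGradient u G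
  grad_memLp_two : ∀ i, MemLp (G i) 2
  grad_memLp : ∀ i, MemLp (G i) (ENNReal.ofReal r)
  hess : ∀ i, IsWeakGradient (G i) (H i)
  hess_memLpLoc : ∀ i j, MemLpLoc 2 (H i j)
  pairing : ∃ C, PairingBound r C R
  equation : ∀ φ : RN N → ℝ, IsTestFunction φ →
    ∫ x, ((∑ i, G i x * partialDeriv i φ x) + u x * φ x) = c * ∫ x, R x * φ x

variable {r c : ℝ} {R u : RN N → ℝ} {G : Fin N → RN N → ℝ} {H : Fin N → Fin N → RN N → ℝ}

lemma PairingBound.integrable_mul {C : ℝ≥0} (hR : PairingBound r C R)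
    (hu : MemLp u (ENNReal.ofReal r)) : Integrable fun x => R x * u x := by
  refine ⟨hR.1.mul hu.1, ?_⟩
  rw [HasFiniteIntegral]
  simp_rw [enorm_mul]
  exact (hR.2 _ hu.1).trans_lt (ENNReal.mul_lt_top ENNReal.coe_lt_top hu.2)

/-- Testing the equation with the solution itself. -/
lemma RegularSolution.energy (h : RegularSolution r c R u G H) :
    (∑ i, ∫ x, G i x ^ 2) + ∫ x, u x ^ 2 = c * ∫ x, R x * u x := by
  obtain ⟨C, hC⟩ := h.pairing
  set ζ : ℕ → RN N → ℝ := fun n x => cutoff N (scale n • x) with hζd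
  have hζ : ∀ n, IsTestFunction (ζ n) := fun n =>
    isTestFunction_cutoff.comp_smul (scale_pos n).ne'
  have hζ' : ∀ i n x, partialDeriv i (ζ n) x = scale n * partialDeriv i (cutoff N) (scale n • x) :=
    fun i n x => partialDeriv_comp_smul i isTestFunction_cutoff.differentiable _ _
  obtain ⟨B, -, hB⟩ := isTestFunction_cutoff.exists_bound (φ := cutoff N)
  have hlim : ∀ x, Tendsto (fun n => ζ n x) atTop (𝓝 1) := fun x => by
    rw [← cutoff_zero (N := N)]
    exact tendsto_comp_scale isTestFunction_cutoff.continuous x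
  -- The cutoffs tend to 1 boundedly, while by `key'` their gradients carry a factor `scale n` and
  -- disappear in the limit.
  have key : ∀ {a : RN N → ℝ}, Integrable a →
      Tendsto (fun n => ∫ x, a x * ζ n x) atTop (𝓝 (∫ x, a x)) := fun {a} ha => by
    have := tendsto_integral_mul_of_bounded ha (fun n => (hζ n).continuous) (fun n x => hB _) hlim
    rwa [mul_one] at this
  have key' : ∀ i, ∀ {a : RN N → ℝ}, Integrable a →
      Tendsto (fun n => ∫ x, a x * partialDeriv i (ζ n) x) atTop (𝓝 0) := fun i {a} ha => by
    obtain ⟨B', hB'0, hB'⟩ := (isTestFunction_cutoff.partialDeriv i).exists_bound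
    have := tendsto_integral_mul_of_bounded ha (fun n => ((hζ n).partialDeriv i).continuous)
      (B := B') (c := 0) (fun n x => ?_) (fun x => ?_)
    · rwa [mul_zero] at this
    · rw [hζ', abs_mul, abs_of_pos (scale_pos n)]
      exact (mul_le_of_le_one_left (abs_nonneg _) (scale_le_one n)).trans (hB' _)
    · simp_rw [hζ']
      have := tendsto_scale.mul (tendsto_comp_scale
        (isTestFunction_cutoff.partialDeriv (N := N) i).continuous x)
      rwa [zero_mul] at this
  have hn := fun n => integral_test_mul h.one_le h.memLp_two h.grad_memLp_two hC h.equation h.grad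
    (MemLpLoc.of_memLp h.memLp) (MemLpLoc.of_memLp h.memLp_two)
    (fun i => MemLpLoc.of_memLp (h.grad_memLp_two i)) (hζ n)
  have hL : Tendsto (fun n => (∑ i, ((∫ x, G i x * (partialDeriv i (ζ n) x * u x)) +
      ∫ x, G i x * (ζ n x * G i x))) + ∫ x, u x * (ζ n x * u x)) atTop
      (𝓝 ((∑ i, (0 + ∫ x, G i x ^ 2)) + ∫ x, u x ^ 2)) := by
    refine Tendsto.add (tendsto_finsetSum _ fun i _ => Tendsto.add ?_ ?_) ?_
    · refine (key' i ((h.grad_memLp_two i).integrable_mul h.memLp_two)).congr fun n => ?_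
      refine integral_congr_ae (Eventually.of_forall fun x => ?_)
      simp only [Pi.mul_apply]
      ring
    · refine (key (h.grad_memLp_two i).integrable_sq).congr fun n => ?_
      refine integral_congr_ae (Eventually.of_forall fun x => ?_)
      simp only
      ring
    · refine (key h.memLp_two.integrable_sq).congr fun n => ?_
      refine integral_congr_ae (Eventually.of_forall fun x => ?_)
      simp only
      ring
  have hRl : Tendsto (fun n => c * ∫ x, R x * (ζ n x * u x)) atTop
      (𝓝 (c * ∫ x, R x * u x)) := by
    refine Tendsto.const_mul c ((key (hC.integrable_mul h.memLp)).congr fun n => ?_)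
    refine integral_congr_ae (Eventually.of_forall fun x => ?_)
    simp only
    ring
  have := tendsto_nhds_unique (hL.congr hn) hRl
  simpa only [zero_add] using this

/-- The local part of the Pohozaev identity. -/
lemma RegularSolution.tendsto_pohozaev (h : RegularSolution r c R u G H) :
    Tendsto (fun n => ∑ j, c * ∫ x, R x * (dilationField n j x * G j x)) atTop
      (𝓝 ((1 - N / 2) * (∑ i, ∫ x, G i x ^ 2) - N / 2 * ∫ x, u x ^ 2)) := by
  obtain ⟨C, hC⟩ := h.pairing
  have hn := fun n j => integral_pohozaev_local h.one_le h.memLp_two h.grad h.grad_memLp_two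
    (fun i => MemLpLoc.of_memLp (h.grad_memLp i)) h.hess h.hess_memLpLoc hC h.equation j
    (isTestFunction_dilationField n j)
  simp_rw [← hn]
  -- The field derivatives tend to the Kronecker delta. The term with G_i G_j keeps the diagonal i =
  -- j, and each one-half term is summed over all N values of j. The conditions `j = j` match the
  -- shape of the limit lemma.
  have e : (1 - (N : ℝ) / 2) * (∑ i, ∫ x, G i x ^ 2) - N / 2 * ∫ x, u x ^ 2 =
      ∑ j, ((∑ i, ((∫ x, G i x * G j x) * (if i = j then 1 else 0) -
        1 / 2 * ((∫ x, G i x ^ 2) * if j = j then 1 else 0))) -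
        1 / 2 * ((∫ x, u x ^ 2) * if j = j then 1 else 0)) := by
    simp only [if_true, mul_one, mul_ite, mul_zero, Finset.sum_sub_distrib, Finset.sum_ite_eq',
      Finset.mem_univ, Finset.sum_const, Finset.card_univ, Fintype.card_fin, nsmul_eq_mul,
      ← Finset.mul_sum, ← pow_two]
    ring
  rw [e]
  refine tendsto_finsetSum _ fun j _ => Tendsto.sub (tendsto_finsetSum _ fun i _ =>
    Tendsto.sub ?_ (Tendsto.const_mul _ ?_)) (Tendsto.const_mul _ ?_)
  · refine (tendsto_integral_mul_partialDeriv_dilationField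
      ((h.grad_memLp_two i).integrable_mul (h.grad_memLp_two j)) i j).congr fun n => ?_
    refine integral_congr_ae (Eventually.of_forall fun x => ?_)
    simp only [Pi.mul_apply]
    ring
  · exact tendsto_integral_mul_partialDeriv_dilationField (h.grad_memLp_two i).integrable_sq j j
  · exact tendsto_integral_mul_partialDeriv_dilationField h.memLp_two.integrable_sq j j

lemma ae_eq_zero_of_integral_sq_le {f : RN N → ℝ} (hf : MemLp f 2) (h : ∫ x, f x ^ 2 ≤ 0) :
    f =ᵐ[volume] 0 := by
  have h0 : ∫ x, f x ^ 2 = 0 := le_antisymm h (integral_nonneg fun x => sq_nonneg _)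
  rw [integral_eq_zero_iff_of_nonneg (fun x => sq_nonneg _) hf.integrable_sq] at h0
  filter_upwards [h0] with x hx
  simpa using hx

/-- A square integrable function with vanishing gradient is zero. -/
lemma RegularSolution.ae_eq_zero_of_grad (h : RegularSolution r c R u G H) (j : Fin N)
    (hG : G j =ᵐ[volume] 0) : u =ᵐ[volume] 0 := by
  have hl := tendsto_integral_mul_partialDeriv_dilationField h.memLp_two.integrable_sq j j
  -- If ∂_j u = 0 then u² integrates to zero against ∂_j of the field. Since that derivative tends
  -- to 1, the integral of u² is zero; a single vanishing partial derivative suffices.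
  have hz : ∀ n, ∫ x, u x ^ 2 * partialDeriv j (dilationField n j) x = 0 := fun n => by
    have := integral_mul_mul_weakPartial (h.grad j) (MemLpLoc.of_memLp h.memLp_two)
      (MemLpLoc.of_memLp (h.grad_memLp_two j)) (isTestFunction_dilationField n j)
    rw [integral_eq_zero_of_ae (by filter_upwards [hG] with x hx; simp [hx])] at this
    linarith
  simp only [hz, if_true, mul_one] at hl
  exact ae_eq_zero_of_integral_sq_le h.memLp_two (tendsto_nhds_unique tendsto_const_nhds hl).ge

/-! ### The nonlocal term of the Pohozaev identity. -/

/-- The nonlocal part of the Pohozaev identity. -/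
lemma HLSAdmissible.tendsto_pohozaev {α θ₁ θ₂ : ℝ} (h : HLSAdmissible N α θ₁ θ₂)
    {F g : RN N → ℝ} {DF Dg : Fin N → RN N → ℝ} (hF : MemLp F (ENNReal.ofReal θ₁))
    (hDF : ∀ j, MemLp (DF j) (ENNReal.ofReal θ₁)) (hwF : IsWeakGradient F DF)
    (hg : MemLp g (ENNReal.ofReal θ₂)) (hDg : ∀ j, MemLp (Dg j) (ENNReal.ofReal θ₂))
    (hwg : IsWeakGradient g Dg) :
    Tendsto (fun n => ∑ j, ((∫ x, rieszConv α g x * (dilationField n j x * DF j x)) +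
        ∫ x, rieszConv α F x * (dilationField n j x * Dg j x))) atTop
      (𝓝 (-(N + α) * ∫ x, rieszConv α g x * F x)) := by
  have hαN := h.lt_dim
  have hpos : 0 < (N : ℝ) - α := sub_pos.2 hαN
  set X : ℕ → Fin N → RN N → ℝ := dilationField with hXd
  have hX : ∀ n j, IsTestFunction (X n j) := isTestFunction_dilationField
  have hXmul : ∀ {θ : ℝ} {f : RN N → ℝ} (n j), MemLp f (ENNReal.ofReal θ) →
      MemLp (fun x => X n j x * f x) (ENNReal.ofReal θ) := fun {θ f} n j hf => by
    obtain ⟨B, -, hB⟩ := (hX n j).exists_bound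
    refine (hf.const_mul B).of_le ((hX n j).continuous.aestronglyMeasurable.mul hf.1)
      (Eventually.of_forall fun x => ?_)
    rw [norm_mul, norm_mul]
    exact mul_le_mul_of_nonneg_right ((hB x).trans (le_abs_self B)) (norm_nonneg _)
  set m : ℕ → Fin N → RN N × RN N → ℝ := fun n j z => normKernel N α (z.1 - z.2) *
    (-((N : ℝ) - α) * ((z.1 - z.2) j * (X n j z.1 - X n j z.2) / ‖z.1 - z.2‖ ^ 2) +
      (partialDeriv j (X n j) z.1 + partialDeriv j (X n j) z.2)) with hm
  have hstep : ∀ n j, (∫ x, rieszConv α g x * (X n j x * DF j x)) +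
      ∫ x, rieszConv α F x * (X n j x * Dg j x) =
      -(rieszConst N α * ∫ z : RN N × RN N, m n j z * (F z.1 * g z.2) ∂volume.prod volume) := by
    intro n j
    rw [h.integral_rieszConv_mul (hXmul n j (hDF j)) hg,
      h.symm.integral_rieszConv_mul (hXmul n j (hDg j)) hF, ← mul_add, ← mul_neg,
      ← h.integral_normKernel_symm hF (hDF j) (hwF j) hg (hDg j) (hwg j) (hX n j)]
    congr 2
    · refine integral_congr_ae (Eventually.of_forall fun z => ?_)
      simp only
      ring
    · rw [← integral_prod_swap]
      refine integral_congr_ae (Eventually.of_forall fun z => ?_)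
      simp only [Prod.fst_swap, Prod.snd_swap, normKernel, norm_sub_rev z.2 z.1]
      ring
  -- The limiting multiplier for the field X(x) = x; the summand 1 + 1 is ∂_j X_j at the two points.
  set m₀ : Fin N → RN N × RN N → ℝ := fun j z => normKernel N α (z.1 - z.2) *
    (-((N : ℝ) - α) * ((z.1 - z.2) j * (z.1 j - z.2 j) / ‖z.1 - z.2‖ ^ 2) + (1 + 1)) with hm₀
  have hlim : ∀ j, Tendsto (fun n => ∫ z : RN N × RN N, m n j z * (F z.1 * g z.2)
      ∂volume.prod volume) atTop
      (𝓝 (∫ z : RN N × RN N, m₀ j z * (F z.1 * g z.2) ∂volume.prod volume)) := by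
    intro j
    obtain ⟨B, hB0, hB⟩ := exists_partialDeriv_dilationField_bound j j
    obtain ⟨L, hL0, hL⟩ := exists_dilationField_lipschitz j
    refine h.tendsto_integral_of_le hF hg (B := (N - α) * L + 2 * B) (fun n => ?_)
      (fun n z hz => ?_) (fun z hz => ?_)
    · have h1 := (hX n j).continuous
      have h2 := ((hX n j).partialDeriv j).continuous
      refine ((measurable_normKernel_sub α).mul (Measurable.add ?_ ?_)).aestronglyMeasurable
      · have h3 : Measurable fun z : RN N × RN N => (z.1 - z.2) j * (X n j z.1 - X n j z.2) :=
          Continuous.measurable (by fun_prop)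
        have h4 : Measurable fun z : RN N × RN N => ‖z.1 - z.2‖ ^ 2 :=
          Continuous.measurable (by fun_prop)
        exact (h3.div h4).const_mul _
      · exact Continuous.measurable (by fun_prop)
    · have hz0 : 0 < ‖z.1 - z.2‖ := norm_pos_iff.2 hz
      simp only [hm]
      rw [abs_mul, abs_of_nonneg (normKernel_nonneg _ _), mul_comm]
      refine mul_le_mul_of_nonneg_right ?_ (normKernel_nonneg _ _)
      refine (abs_add_le _ _).trans (add_le_add ?_ ?_)
      · rw [abs_mul, abs_neg, abs_of_pos hpos, abs_div, abs_mul, abs_of_pos (pow_pos hz0 2)]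
        refine mul_le_mul_of_nonneg_left ?_ hpos.le
        rw [div_le_iff₀ (pow_pos hz0 2)]
        calc |(z.1 - z.2) j| * |X n j z.1 - X n j z.2| ≤
              ‖z.1 - z.2‖ * (L * ‖z.1 - z.2‖) :=
              mul_le_mul (abs_apply_le_norm _ j) (hL n _ _) (abs_nonneg _) (norm_nonneg _)
          _ = L * ‖z.1 - z.2‖ ^ 2 := by ring
      · refine (abs_add_le _ _).trans ?_
        linarith [hB n z.1, hB n z.2]
    · have h1 := (tendsto_dilationField j z.1).sub (tendsto_dilationField j z.2)
      have h2 := (tendsto_partialDeriv_dilationField j j z.1).add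
        (tendsto_partialDeriv_dilationField j j z.2)
      simp only [if_true] at h2
      exact ((((h1.const_mul _).div_const _).const_mul _).add h2).const_mul _
  -- Summed over j, the difference quotients give exactly 1 and the divergences give 2N, so the
  -- total factor is -(N-α) + 2N = N + α.
  have hsum : ∑ j, ∫ z : RN N × RN N, m₀ j z * (F z.1 * g z.2) ∂volume.prod volume =
      (N + α) * ∫ z : RN N × RN N, normKernel N α (z.1 - z.2) * (F z.1 * g z.2)
        ∂volume.prod volume := by
    have hI : ∀ j, Integrable (fun z : RN N × RN N => m₀ j z * (F z.1 * g z.2))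
        (volume.prod volume) := fun j => by
      refine h.integrable_of_le hF hg (B := (N - α) + 2) ?_ ?_
      · refine ((measurable_normKernel_sub α).mul (Measurable.add ?_ ?_)).aestronglyMeasurable
        · have h3 : Measurable fun z : RN N × RN N => (z.1 - z.2) j * (z.1 j - z.2 j) :=
            Continuous.measurable (by fun_prop)
          have h4 : Measurable fun z : RN N × RN N => ‖z.1 - z.2‖ ^ 2 :=
            Continuous.measurable (by fun_prop)
          exact (h3.div h4).const_mul _
        · exact measurable_const
      · filter_upwards [ae_prod_fst_ne_snd h.dim_pos] with z hz
        have hz0 : 0 < ‖z.1 - z.2‖ := norm_pos_iff.2 hz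
        simp only [hm₀]
        rw [abs_mul, abs_of_nonneg (normKernel_nonneg _ _), mul_comm]
        refine mul_le_mul_of_nonneg_right ?_ (normKernel_nonneg _ _)
        refine (abs_add_le _ _).trans (add_le_add ?_ (by norm_num))
        rw [← PiLp.sub_apply, abs_mul, abs_neg, abs_of_pos hpos, abs_div, abs_mul,
          abs_of_pos (pow_pos hz0 2)]
        refine mul_le_of_le_one_right hpos.le ?_
        rw [div_le_one (pow_pos hz0 2), pow_two]
        exact mul_le_mul (abs_apply_le_norm _ j) (abs_apply_le_norm _ j) (abs_nonneg _)
          (norm_nonneg _)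
    rw [← integral_finsetSum _ fun j _ => hI j, ← integral_const_mul]
    refine integral_congr_ae ?_
    filter_upwards [ae_prod_fst_ne_snd h.dim_pos] with z hz
    have hz0 : ‖z.1 - z.2‖ ^ 2 ≠ 0 := by simpa using hz
    have h1 : ∑ j, (z.1 - z.2) j * (z.1 j - z.2 j) = ‖z.1 - z.2‖ ^ 2 := by
      rw [EuclideanSpace.norm_sq_eq]
      refine Finset.sum_congr rfl fun j _ => ?_
      rw [← PiLp.sub_apply, Real.norm_eq_abs, sq_abs, pow_two]
    simp only [hm₀]
    rw [← Finset.sum_mul, ← Finset.mul_sum, Finset.sum_add_distrib, ← Finset.mul_sum,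
      ← Finset.sum_div, h1, div_self hz0]
    simp only [Finset.sum_const, Finset.card_univ, Fintype.card_fin, nsmul_eq_mul]
    ring
  simp_rw [hstep]
  have hfin := tendsto_finsetSum Finset.univ fun j _ => ((hlim j).const_mul (rieszConst N α)).neg
  refine hfin.trans (le_of_eq ?_)
  rw [Finset.sum_neg_distrib, ← Finset.mul_sum, hsum, h.integral_rieszConv_mul hF hg]
  congr 1
  ring

/-! ### From the hypotheses to regular solutions. -/

/-- The regularity assumptions of the theorem provide a `RegularSolution`. -/
lemma exists_regularSolution {r c : ℝ} {R u : RN N → ℝ} (hr : 1 ≤ r) (h1 : MemH1 u)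
    (h2 : MemW22Loc u) (h3 : MemW1 r u) (hR : ∃ C, PairingBound r C R)
    (heq : ∃ G : Fin N → RN N → ℝ, IsWeakGradient u G ∧
      ∀ φ : RN N → ℝ, IsTestFunction φ →
        ∫ x, ((∑ i, G i x * partialDeriv i φ x) + u x * φ x) = c * ∫ x, R x * φ x) :
    ∃ G H, RegularSolution r c R u G H := by
  have e2 : ENNReal.ofReal 2 = 2 := by simp
  obtain ⟨hu2, G₁, hG₁, hG₁m⟩ := h1
  obtain ⟨-, G₂, hG₂, hG₂m⟩ := h2
  obtain ⟨hur, G₃, hG₃, hG₃m⟩ := h3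
  obtain ⟨G, hG, he⟩ := heq
  choose hG₂l H hH hHm using hG₂m
  rw [e2] at hu2
  simp_rw [e2] at hG₁m
  -- The hypotheses each supply their own weak gradient. Uniqueness almost everywhere transfers all
  -- integrability and the Hessian to the gradient occurring in the equation.
  exact ⟨G, H, hr, hu2, hur, hG, fun i => (hG₁m i).ae_eq ((hG₁ i).ae_eq (hG i)),
    fun i => (hG₃m i).ae_eq ((hG₃ i).ae_eq (hG i)),
    fun i j => (hH i j).congr ((hG₂ i).ae_eq (hG i)) (ae_eq_refl _), hHm, hR, he⟩

lemma RegularSolution.weakGradient_abs_rpow {θ p c : ℝ} {R u : RN N → ℝ}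
    {G : Fin N → RN N → ℝ} {H : Fin N → Fin N → RN N → ℝ} (hθ : 1 < θ) (hp : 1 < p)
    (h : RegularSolution (θ * p) c R u G H) :
    IsWeakGradient (fun x => |u x| ^ p) fun i x => powDeriv p (u x) * G i x := by
  have hle : ENNReal.ofReal p ≤ ENNReal.ofReal (θ * p) :=
    ENNReal.ofReal_le_ofReal (by nlinarith)
  exact fun i => (h.grad i).abs_rpow hp ((MemLpLoc.of_memLp h.memLp).mono_exponent hle)
    ((MemLpLoc.of_memLp (h.grad_memLp i)).mono_exponent hle)

lemma abs_rpow_sub_two_mul_mul_self {p : ℝ} (hp : 1 < p) (t : ℝ) :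
    |t| ^ (p - 2) * t * t = |t| ^ p := by
  rcases eq_or_ne t 0 with rfl | ht
  · simp [Real.zero_rpow (by linarith : p ≠ 0)]
  · have h0 : 0 < |t| := abs_pos.2 ht
    rw [mul_assoc, ← pow_two, ← sq_abs, ← Real.rpow_natCast, ← Real.rpow_add h0]
    norm_num

lemma integral_rieszConv_mul_comm {α θ₁ θ₂ : ℝ} (h : HLSAdmissible N α θ₁ θ₂) {F g : RN N → ℝ}
    (hF : MemLp F (ENNReal.ofReal θ₁)) (hg : MemLp g (ENNReal.ofReal θ₂)) :
    ∫ x, rieszConv α F x * g x = ∫ x, rieszConv α g x * F x := by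
  rw [h.integral_rieszConv_mul hF hg, h.symm.integral_rieszConv_mul hg hF, ← integral_prod_swap]
  congr 1
  refine integral_congr_ae (Eventually.of_forall fun z => ?_)
  simp only [Prod.fst_swap, Prod.snd_swap, normKernel, norm_sub_rev z.2 z.1]
  ring

end HartreeSystem

end

/-! ### Combining the energy and Pohozaev identities. -/

open HartreeSystem in
theorem theorem1p5 (N : ℕ) (hN : 1 ≤ N) (α p q θ₁ θ₂ : ℝ)
    (hα : 0 < α) (hαN : α < N) (hp : 1 < p) (hq : 1 < q)
    (hθ₁ : 1 < θ₁) (hθ₂ : 1 < θ₂) (hθ : 1 / θ₁ + 1 / θ₂ = (N + α) / N)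
    (u v : HartreeSystem.RN N → ℝ)
    (huv : HartreeSystem.IsWeakSolution α p q u v)
    (hu₂ : HartreeSystem.MemW22Loc u) (hu₁ : HartreeSystem.MemW1 (θ₁ * p) u)
    (hv₂ : HartreeSystem.MemW22Loc v) (hv₁ : HartreeSystem.MemW1 (θ₂ * q) v)
    (hpq : (p + q) * N ≤ 2 * (N + α) ∨ (p + q) * ((N : ℝ) - 2) ≥ 2 * (N + α)) :
    u =ᵐ[volume] 0 ∧ v =ᵐ[volume] 0 := by
  have h : HLSAdmissible N α θ₁ θ₂ := ⟨hN, hα, hαN, hθ₁, hθ₂, hθ⟩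
  have hF : MemLp (fun x => |u x| ^ p) (ENNReal.ofReal θ₁) :=
    memLp_abs_rpow (by linarith) hu₁.1
  have hg : MemLp (fun x => |v x| ^ q) (ENNReal.ofReal θ₂) :=
    memLp_abs_rpow (by linarith) hv₁.1
  obtain ⟨G, H, hu⟩ := exists_regularSolution (by nlinarith) huv.memH1_left hu₂ hu₁
    (h.exists_pairingBound hp hu₁.1 hg) huv.equation_left
  obtain ⟨G', H', hv⟩ := exists_regularSolution (by nlinarith) huv.memH1_right hv₂ hv₁
    (h.symm.exists_pairingBound hq hv₁.1 hF) huv.equation_right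
  set E : ℝ := ∫ x, rieszConv α (fun y => |v y| ^ q) x * |u x| ^ p with hE
  have Eu := hu.energy
  have Ev := hv.energy
  simp only [mul_assoc (rieszConv α _ _), abs_rpow_sub_two_mul_mul_self hp] at Eu
  simp only [mul_assoc (rieszConv α _ _), abs_rpow_sub_two_mul_mul_self hq] at Ev
  rw [integral_rieszConv_mul_comm h hF hg, ← hE] at Ev
  rw [← hE] at Eu
  have hpq0 : 0 < p + q := by linarith
  have hP := h.tendsto_pohozaev hF
    (fun j => memLp_powDeriv_mul hθ₁ hp hu₁.1 (hu.grad_memLp j))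
    (hu.weakGradient_abs_rpow hθ₁ hp) hg
    (fun j => memLp_powDeriv_mul hθ₂ hq hv₁.1 (hv.grad_memLp j))
    (hv.weakGradient_abs_rpow hθ₂ hq)
  -- The coefficients 2p/(p+q) and 2q/(p+q) absorb the factors p and q of the derivatives of |u|^p
  -- and |v|^q, leaving the common factor 2/(p+q). This makes the two nonlinear terms combine into
  -- the symmetric expression of `HLSAdmissible.tendsto_pohozaev`.
  have hlim := (hu.tendsto_pohozaev.add hv.tendsto_pohozaev).congr (f₂ := fun n =>
    2 / (p + q) * ∑ j, ((∫ x, rieszConv α (fun y => |v y| ^ q) x *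
      (dilationField n j x * (powDeriv p (u x) * G j x))) +
        ∫ x, rieszConv α (fun y => |u y| ^ p) x *
          (dilationField n j x * (powDeriv q (v x) * G' j x)))) fun n => by
    rw [← Finset.sum_add_distrib, Finset.mul_sum]
    refine Finset.sum_congr rfl fun j _ => ?_
    rw [mul_add]
    congr 1
    · rw [← integral_const_mul, ← integral_const_mul]
      refine integral_congr_ae (Filter.Eventually.of_forall fun x => ?_)
      simp only [powDeriv]
      ring
    · rw [← integral_const_mul, ← integral_const_mul]
      refine integral_congr_ae (Filter.Eventually.of_forall fun x => ?_)
      simp only [powDeriv]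
      ring
  have key := tendsto_nhds_unique hlim (hP.const_mul (2 / (p + q)))
  rw [← hE] at key
  have sq_nonneg' : ∀ f : RN N → ℝ, 0 ≤ ∫ x, f x ^ 2 := fun f =>
    integral_nonneg fun x => sq_nonneg _
  have hAu : 0 ≤ ∑ i, ∫ x, G i x ^ 2 := Finset.sum_nonneg fun i _ => sq_nonneg' _
  have hAv : 0 ≤ ∑ i, ∫ x, G' i x ^ 2 := Finset.sum_nonneg fun i _ => sq_nonneg' _
  have hBu := sq_nonneg' u
  have hBv := sq_nonneg' v
  set Au := ∑ i, ∫ x, G i x ^ 2 with hAud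
  set Av := ∑ i, ∫ x, G' i x ^ 2 with hAvd
  set Bu := ∫ x, u x ^ 2
  set Bv := ∫ x, v x ^ 2
  have hsum : Au + Av + (Bu + Bv) = 2 * E := by
    have : 2 * p / (p + q) * E + 2 * q / (p + q) * E = 2 * E := by field_simp
    linarith
  have hkey : (p + q) * (((N : ℝ) / 2 - 1) * (Au + Av) + N / 2 * (Bu + Bv)) =
      (N + α) * (Au + Av + (Bu + Bv)) := by
    rw [hsum]
    have : (p + q) * (2 / (p + q) * (-(N + α) * E)) = -((N + α) * (2 * E)) := by field_simp
    rw [← key] at this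
    linarith
  rcases hpq with hpq | hpq
  -- Here `hkey` is used in the form ((p+q)N - 2(N+α))(A + B) = 2(p+q)A, whose left-hand side is
  -- nonpositive.
  · have hA : Au + Av ≤ 0 := by
      nlinarith
    have hz : ∀ {D : Fin N → RN N → ℝ}, (∀ i, MemLp (D i) 2) → ∑ i, ∫ x, D i x ^ 2 ≤ 0 →
        D ⟨0, hN⟩ =ᵐ[volume] 0 := fun {D} hD hs =>
      ae_eq_zero_of_integral_sq_le (hD _) ((Finset.single_le_sum (f := fun i => ∫ x, D i x ^ 2)
        (fun i _ => sq_nonneg' _) (Finset.mem_univ _)).trans hs)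
    exact ⟨hu.ae_eq_zero_of_grad _ (hz hu.grad_memLp_two (by linarith)),
      hv.ae_eq_zero_of_grad _ (hz hv.grad_memLp_two (by linarith))⟩
  -- Here `hkey` is used in the form ((p+q)(N-2) - 2(N+α))(A + B) = -2(p+q)B, whose left-hand side
  -- is nonnegative.
  · have hB : Bu + Bv ≤ 0 := by
      nlinarith
    exact ⟨ae_eq_zero_of_integral_sq_le hu.memLp_two (by linarith),
      ae_eq_zero_of_integral_sq_le hv.memLp_two (by linarith)⟩
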